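/- Let $(X^4,g)$ be a smooth Riemannian manifold of dimension $4$ (possibly with boundary), let $M^3$ be a smooth manifold of dimension $3$ and let $\iota\colon M\hookrightarrow X$ be a smooth embedding, with a (locally defined) smooth unit normal field $\partial_0=N$. Let $h=\iota^*g$ be the induced metric and let $\nabla$ be its Levi-Civita connection; indices $i,j,k,\dots$ refer to $M$ and are raised and lowered with $h$. Let $L(Y,Z)=-g(\bar\nabla_Y Z,N)$ be the second fundamental form ($\bar\nabla$ the Levi-Civita connection of $g$), and let $\mathring L=L-\tfrac13\mathrm{tr}_h(L)\,h$ be its trace-free part. Put $(\mathring L^2)_{ij}=\mathring L_i{}^k\mathring L_{kj}$ and let $(\mathring L^2)_\circ$ be the trace-free part of $\mathring L^2$. Let $J=\mathrm{scal}_h/4$ and let $P=\mathrm{Ric}_h-J\,h$ be the Schouten tensor of $h$. The curvature tensor is $R(Y,Z)V=\nabla_Y\nabla_ZV-\nabla_Z\nabla_YV-\nabla_{[Y,Z]}V$ with components $R_{ijkl}=\langle R(\partial_i,\partial_j)\partial_k,\partial_l\rangle$, the Ricci tensor is $\mathrm{Ric}_{jk}=R_{ijk}{}^i$, and $\overline W$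 is the Weyl tensor of $g$, i.e. the totally trace-free part of its curvature tensor. Let $\overline W_0$ be the $3$-tensor on $M$ with components $(\overline W_0)_{ijk}=\overline W(\partial_i,\partial_j,\partial_k,N)$. Let $\delta$ denote the divergence, $\delta(b)_j=\nabla^ib_{ij}$ on symmetric bilinear forms and $\delta(\alpha)=\nabla^i\alpha_i$ on $1$-forms, let $\Delta=\nabla^k\nabla_k$ be the Bochner Laplacian, and let $(\cdot,\cdot)$, $|\cdot|$ be the scalar products and norms on tensors given by full contraction with $h$. Then, on $M$, $$\delta\delta\big((\mathring L^2)_\circ\big)+\big(P,(\mathring L^2)_\circ\big)=\tfrac23(\mathring L,\Delta\mathring L)+\tfrac13|\nabla\mathring L|^2+\tfrac12|\delta(\mathring L)|^2-\tfrac23J|\mathring L|^2+\tfrac43\,\mathring L^{ij}\nabla^k(\overline W_0)_{kij}-\tfrac12|\overline W_0|^2 .$$ -/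

import Mathlib

open scoped Manifold ContDiff Topology

noncomputable section

namespace Hypersurface

/-! ## Riemannian geometry in local coordinates

A tensor field on a coordinate domain of dimension `n` is given by its component functions.
Partial derivatives are taken within a set `D` of coordinates: `D` is everything for a manifold
without boundary, and the range of the model with corners (e.g. a half-space) in general. -/

/-- The coordinate space of dimension `n`. -/
abbrev Coord (n : ℕ) : Type := EuclideanSpace ℝ (Fin n)

/-- Components `α_i`. -/
abbrev OneTensor (n : ℕ) : Type := Coord n → Fin n → ℝ

/-- Components `b_{ij}`. -/
abbrev TwoTensor (n : ℕ) : Type := Coord n → Fin n → Fin n → ℝ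

/-- Components `t_{ijk}`. -/
abbrev ThreeTensor (n : ℕ) : Type := Coord n → Fin n → Fin n → Fin n → ℝ

/-- Components `t_{ijkl}`. -/
abbrev FourTensor (n : ℕ) : Type := Coord n → Fin n → Fin n → Fin n → Fin n → ℝ

variable {n m : ℕ}

/-- The partial derivative `∂_i u`. -/
def pd (D : Set (Coord n)) (i : Fin n) (u : Coord n → ℝ) (x : Coord n) : ℝ :=
  fderivWithin ℝ u D x (EuclideanSpace.single i 1)

/-- The components `g^{ij}` of the inverse metric. -/
def invMetric (g : TwoTensor n) (x : Coord n) (i j : Fin n) : ℝ :=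
  ((Matrix.of (g x))⁻¹ : Matrix (Fin n) (Fin n) ℝ) i j

/-- The Christoffel symbols `Γ^k_{ij}` of the Levi-Civita connection of `g`. -/
def christoffel (D : Set (Coord n)) (g : TwoTensor n) (x : Coord n) (k i j : Fin n) : ℝ :=
  (1 / 2) * ∑ l, invMetric g x k l *
    (pd D i (fun y => g y j l) x + pd D j (fun y => g y i l) x - pd D l (fun y => g y i j) x)

/-- `∇_i α_j`; the index of differentiation comes first. -/
def nabla1 (D : Set (Coord n)) (g : TwoTensor n) (α : OneTensor n) : TwoTensor n :=
  fun x i j => pd D i (fun y => α y j) x - ∑ a, christoffel D g x a i j * α x a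

/-- `∇_k b_{ij}`; the index of differentiation comes first. -/
def nabla2 (D : Set (Coord n)) (g : TwoTensor n) (b : TwoTensor n) : ThreeTensor n :=
  fun x k i j => pd D k (fun y => b y i j) x
    - ∑ a, christoffel D g x a k i * b x a j
    - ∑ a, christoffel D g x a k j * b x i a

/-- `∇_l t_{kij}`; the index of differentiation comes first. -/
def nabla3 (D : Set (Coord n)) (g : TwoTensor n) (t : ThreeTensor n) : FourTensor n :=
  fun x l k i j => pd D l (fun y => t y k i j) x
    - ∑ a, christoffel D g x a l k * t x a i j
    - ∑ a, christoffel D g x a l i * t x k a j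
    - ∑ a, christoffel D g x a l j * t x k i a

/-- The scalar product `(α, β) = α_i β^i`. -/
def inner1 (g : TwoTensor n) (α β : OneTensor n) (x : Coord n) : ℝ :=
  ∑ i, ∑ j, invMetric g x i j * α x i * β x j

/-- The scalar product `(a, b) = a_{ij} b^{ij}`. -/
def inner2 (g : TwoTensor n) (a b : TwoTensor n) (x : Coord n) : ℝ :=
  ∑ i, ∑ j, ∑ k, ∑ l, invMetric g x i k * invMetric g x j l * a x i j * b x k l

/-- The scalar product `(s, t) = s_{ijk} t^{ijk}`. -/
def inner3 (g : TwoTensor n) (s t : ThreeTensor n) (x : Coord n) : ℝ :=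
  ∑ i, ∑ j, ∑ k, ∑ a, ∑ b, ∑ c,
    invMetric g x i a * invMetric g x j b * invMetric g x k c * s x i j k * t x a b c

/-- The trace `tr_g b = b_i^i`. -/
def trace (g : TwoTensor n) (b : TwoTensor n) (x : Coord n) : ℝ :=
  ∑ i, ∑ j, invMetric g x i j * b x i j

/-- The trace-free part `b_∘ = b - (1/n) tr_g(b) g`. -/
def traceFree (g : TwoTensor n) (b : TwoTensor n) : TwoTensor n :=
  fun x i j => b x i j - trace g b x / n * g x i j

/-- The square `(b²)_{ij} = b_i^k b_{kj}`. -/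
def square (g : TwoTensor n) (b : TwoTensor n) : TwoTensor n :=
  fun x i j => ∑ k, ∑ l, invMetric g x l k * b x i l * b x k j

/-- The divergence `δ(α) = ∇^i α_i`. -/
def div1 (D : Set (Coord n)) (g : TwoTensor n) (α : OneTensor n) (x : Coord n) : ℝ :=
  ∑ i, ∑ j, invMetric g x i j * nabla1 D g α x i j

/-- The divergence `δ(b)_j = ∇^i b_{ij}`. -/
def div2 (D : Set (Coord n)) (g : TwoTensor n) (b : TwoTensor n) : OneTensor n :=
  fun x j => ∑ i, ∑ k, invMetric g x k i * nabla2 D g b x k i j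

/-- The divergence `∇^k t_{kij}` in the first slot. -/
def div3 (D : Set (Coord n)) (g : TwoTensor n) (t : ThreeTensor n) : TwoTensor n :=
  fun x i j => ∑ k, ∑ l, invMetric g x l k * nabla3 D g t x l k i j

/-- The Bochner Laplacian `(Δb)_{ij} = ∇^k ∇_k b_{ij}`. -/
def laplacian2 (D : Set (Coord n)) (g : TwoTensor n) (b : TwoTensor n) : TwoTensor n :=
  fun x i j => ∑ k, ∑ l, invMetric g x k l * nabla3 D g (nabla2 D g b) x k l i j

/-- `R_{ijk}^l`, where `R(∂_i, ∂_j) ∂_k = ∇_i ∇_j ∂_k - ∇_j ∇_i ∂_k = R_{ijk}^l ∂_l`. -/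
def riemannUp (D : Set (Coord n)) (g : TwoTensor n) (x : Coord n) (i j k l : Fin n) : ℝ :=
  pd D i (fun y => christoffel D g y l j k) x - pd D j (fun y => christoffel D g y l i k) x
    + ∑ a, (christoffel D g x l i a * christoffel D g x a j k
      - christoffel D g x l j a * christoffel D g x a i k)

/-- The curvature tensor `R_{ijkl} = R_{ijk}^a g_{al}`. -/
def riemann (D : Set (Coord n)) (g : TwoTensor n) : FourTensor n :=
  fun x i j k l => ∑ a, riemannUp D g x i j k a * g x a l

/-- The Ricci tensor `Ric_{jk} = R_{ijk}^i`, which is positive on round spheres. -/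
def ricci (D : Set (Coord n)) (g : TwoTensor n) : TwoTensor n :=
  fun x j k => ∑ i, riemannUp D g x i j k i

/-- `J = scal / (2 (n - 1))`; used for `n ≥ 3` only. -/
def schoutenJ (D : Set (Coord n)) (g : TwoTensor n) (x : Coord n) : ℝ :=
  trace g (ricci D g) x / (2 * ((n : ℝ) - 1))

/-- The Schouten tensor `P = (Ric - J g) / (n - 2)`; used for `n ≥ 3` only. -/
def schouten (D : Set (Coord n)) (g : TwoTensor n) : TwoTensor n :=
  fun x i j => (ricci D g x i j - schoutenJ D g x * g x i j) / ((n : ℝ) - 2)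

/-- The Weyl tensor, i.e. the trace-free part of `R_{ijkl}` in the decomposition
`R_{ijkl} = W_{ijkl} - P_{ik} g_{jl} + P_{jk} g_{il} - P_{jl} g_{ik} + P_{il} g_{jk}`. -/
def weyl (D : Set (Coord n)) (g : TwoTensor n) : FourTensor n :=
  fun x i j k l => riemann D g x i j k l
    - (-(schouten D g x i k * g x j l) + schouten D g x j k * g x i l
      - schouten D g x j l * g x i k + schouten D g x i l * g x j k)

/-! ## Hypersurfaces in local coordinates

`f` is a map written in coordinates, `G` is the metric of the target in coordinates, `D` is the
set of target coordinates within which derivatives are taken, and `ν^a` are the components of a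
vector field `N` along `f`. -/

/-- `∂_i f^a`, the components of the tangent vector `df(∂_i)`. -/
def tangent (f : Coord n → Coord m) (x : Coord n) (a : Fin m) (i : Fin n) : ℝ :=
  pd Set.univ i (fun y => f y a) x

/-- The induced metric `h_{ij} = G(df(∂_i), df(∂_j))`. -/
def inducedMetric (G : TwoTensor m) (f : Coord n → Coord m) : TwoTensor n :=
  fun x i j => ∑ a, ∑ b, G (f x) a b * tangent f x a i * tangent f x b j

/-- The components of the ambient covariant derivative of the tangent field `df(∂_j)` in the
direction of `df(∂_i)`: `∂_i ∂_j f^a + Γ^a_{cd}(f) ∂_i f^c ∂_j f^d`. -/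
def ambientDeriv (D : Set (Coord m)) (G : TwoTensor m) (f : Coord n → Coord m)
    (x : Coord n) (i j : Fin n) (a : Fin m) : ℝ :=
  pd Set.univ i (fun y => tangent f y a j) x
    + ∑ c, ∑ d, christoffel D G (f x) a c d * tangent f x c i * tangent f x d j

/-- The second fundamental form `L(Y, Z) = - G(∇_Y Z, N)`, where `∇` is the ambient
Levi-Civita connection. -/
def secondFundamentalForm (D : Set (Coord m)) (G : TwoTensor m) (f : Coord n → Coord m)
    (ν : Coord n → Fin m → ℝ) : TwoTensor n :=
  fun x i j => -∑ a, ∑ b, G (f x) a b * ambientDeriv D G f x i j a * ν x b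

/-- The tensor `(W₀)_{ijk} = W(∂_i, ∂_j, ∂_k, N)` on the hypersurface, with `W` the ambient
Weyl tensor. -/
def weylNormal (D : Set (Coord m)) (G : TwoTensor m) (f : Coord n → Coord m)
    (ν : Coord n → Fin m → ℝ) : ThreeTensor n :=
  fun x i j k => ∑ a, ∑ b, ∑ c, ∑ d, weyl D G (f x) a b c d *
    tangent f x a i * tangent f x b j * tangent f x c k * ν x d

end Hypersurface

/-! ## From manifolds to coordinates -/

namespace Hypersurface

variable {n m : ℕ}
  {M : Type*} [TopologicalSpace M] [ChartedSpace (EuclideanSpace ℝ (Fin n)) M]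
  {H : Type*} [TopologicalSpace H] {I : ModelWithCorners ℝ (EuclideanSpace ℝ (Fin m)) H}
  {X : Type*} [TopologicalSpace X] [ChartedSpace H X]

/-- The coordinate vector field `∂_a` of the chart `ψ`, at the point with coordinates `y`. -/
def coordVector (I : ModelWithCorners ℝ (EuclideanSpace ℝ (Fin m)) H)
    (ψ : OpenPartialHomeomorph X H) (y : EuclideanSpace ℝ (Fin m)) (a : Fin m) :
    TangentSpace I ((ψ.extend I).symm y) :=
  mfderivWithin 𝓘(ℝ, EuclideanSpace ℝ (Fin m)) I (ψ.extend I).symm (Set.range I) y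
    (EuclideanSpace.single a (1 : ℝ))

/-- The components `g_{ab} = g(∂_a, ∂_b)` of a Riemannian metric in the chart `ψ`. -/
def metricInChart [IsManifold I ∞ X]
    (g : Bundle.ContMDiffRiemannianMetric I ∞ (EuclideanSpace ℝ (Fin m))
      (fun q : X => TangentSpace I q))
    (ψ : OpenPartialHomeomorph X H) : TwoTensor m :=
  fun y a b => g.inner ((ψ.extend I).symm y) (coordVector I ψ y a) (coordVector I ψ y b)

/-- The map `ι` written in the charts `φ` and `ψ`. -/
def mapInCharts (I : ModelWithCorners ℝ (EuclideanSpace ℝ (Fin m)) H) (ι : M → X)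
    (φ : OpenPartialHomeomorph M (EuclideanSpace ℝ (Fin n)))
    (ψ : OpenPartialHomeomorph X H) : Coord n → Coord m :=
  fun x => ψ.extend I (ι ((φ.extend (𝓡 n)).symm x))

/-- The components in the chart `ψ` of a vector field `N` along `ι`, as functions of the
coordinates of the chart `φ`. -/
def vectorInCharts (ι : M → X) (N : ∀ p : M, TangentSpace I (ι p))
    (φ : OpenPartialHomeomorph M (EuclideanSpace ℝ (Fin n)))
    (ψ : OpenPartialHomeomorph X H) : Coord n → Fin m → ℝ :=
  fun x a =>
    let p : M := (φ.extend (𝓡 n)).symm x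
    let v : EuclideanSpace ℝ (Fin m) :=
      mfderiv I 𝓘(ℝ, EuclideanSpace ℝ (Fin m)) (ψ.extend I) (ι p) (N p)
    v a

/-- `N` is a smooth unit normal vector field of `ι` on the open set `U`. -/
structure IsUnitNormalOn [IsManifold I ∞ X]
    (g : Bundle.ContMDiffRiemannianMetric I ∞ (EuclideanSpace ℝ (Fin m))
      (fun q : X => TangentSpace I q))
    (ι : M → X) (N : ∀ p : M, TangentSpace I (ι p)) (U : Set M) : Prop where
  smooth : ContMDiffOn (𝓡 n) I.tangent ∞ (fun p => (⟨ι p, N p⟩ : TangentBundle I X)) U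
  unit : ∀ p ∈ U, g.inner (ι p) (N p) (N p) = 1
  normal : ∀ p ∈ U, ∀ v : TangentSpace (𝓡 n) p,
    g.inner (ι p) (mfderiv (𝓡 n) I ι p v) (N p) = 0

end Hypersurface

end

open Hypersurface

open scoped Manifold ContDiff Topology
open Hypersurface

/-! Write A for the trace-free second fundamental form, B = ∇A, C = ∇∇A, d = δA, and W for the
tensor W₀. All indices below refer to an orthonormal frame.

The Leibniz rule gives δδ of the trace-free part of A² as X + Y + |d|² + B_{ijk}B_{jik} - (2/3)(A,
ΔA) - (2/3)|B|². Here X = A_{ij}C_{kikj} and Y = A_{ij}C_{ikkj} contain the same second derivatives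
in opposite orders, and the last two terms come from Δ|A|²/3. This is `double_divergence_square`.

The ambient geometry enters only through Codazzi. Splitting the ambient curvature into Weyl and
Schouten parts shows that W_{kij} is -(B_{kij} - B_{ikj}) plus a term t_i h_{kj} - t_k h_{ij} for
some one-form t. The tangential trace of W vanishes, which forces t = d/2, so neither the ambient
Schouten tensor nor the derivative of the mean curvature has to be computed. Two consequences
follow: |W|² = 2|B|² - 2B_{ijk}B_{jik} - |d|² (`norm_sq_codazzi`), and A_{ij}∇_k W_{kij} = -(A, ΔA)
+ X + Y/2.

The commutator X - Y is a curvature term. In dimension three, for trace-free A, it equals 3(Ric, A²)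
- 2J|A|² (`curvature_term_dim_three`). Since X + Y = (4/3)X + (2/3)Y - (1/3)(X - Y), its Ricci part
cancels against the one in (P, (A²)_∘) = (Ric, A²) - (4/3)J|A|², leaving -(2/3)J|A|². This
bookkeeping is `orthonormal_identity`; `IsMetricOn.divergence_square_identity` transfers it to
coordinates through an orthonormal frame at one point.

The Codazzi equation is derived from the connection pulled back along the map f, which is metric and
torsion free and has the ambient curvature. The last part checks that charts of the manifolds
produce the coordinate data used here. Derivatives on X are taken within the range of the model, so
that boundary points of X are covered. -/

namespace Hypersurface

/-! ### Calculus with partial derivatives within a set -/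

/-- `T` is a relatively open piece of the set `D`, which has unique derivatives and dense enough
interior for second derivatives within `D` to be symmetric. -/
structure IsChartDomain {n : ℕ} (D T : Set (Coord n)) : Prop where
  subset : T ⊆ D
  mem_nhdsWithin : ∀ z ∈ T, T ∈ 𝓝[D] z
  uniqueDiffOn : UniqueDiffOn ℝ D
  subset_closure : T ⊆ closure (interior D)

/-- `u` is smooth within `D` at all points of `T`. -/
def SmoothIn {n : ℕ} (D T : Set (Coord n)) (u : Coord n → ℝ) : Prop :=
  ∀ z ∈ T, ContDiffWithinAt ℝ ∞ u D z

section Calculus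

variable {n : ℕ} {D T : Set (Coord n)} {u v : Coord n → ℝ} {z : Coord n} {k : Fin n}

theorem IsChartDomain.of_isOpen (hT : IsOpen T) : IsChartDomain Set.univ T where
  subset := Set.subset_univ _
  mem_nhdsWithin z hz := by simpa using hT.mem_nhds hz
  uniqueDiffOn := uniqueDiffOn_univ
  subset_closure := by simp

theorem SmoothIn.const (c : ℝ) : SmoothIn D T (fun _ => c) := fun _ _ => contDiffWithinAt_const

theorem SmoothIn.add (hu : SmoothIn D T u) (hv : SmoothIn D T v) :
    SmoothIn D T (fun y => u y + v y) := fun z hz => (hu z hz).add (hv z hz)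

theorem SmoothIn.sub (hu : SmoothIn D T u) (hv : SmoothIn D T v) :
    SmoothIn D T (fun y => u y - v y) := fun z hz => (hu z hz).sub (hv z hz)

theorem SmoothIn.neg (hu : SmoothIn D T u) : SmoothIn D T (fun y => -u y) :=
  fun z hz => (hu z hz).neg

theorem SmoothIn.mul (hu : SmoothIn D T u) (hv : SmoothIn D T v) :
    SmoothIn D T (fun y => u y * v y) := fun z hz => (hu z hz).mul (hv z hz)

theorem SmoothIn.div_const (hu : SmoothIn D T u) (c : ℝ) : SmoothIn D T (fun y => u y / c) :=
  fun z hz => (hu z hz).div_const c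

theorem SmoothIn.sum {ι : Type*} {s : Finset ι} {u : ι → Coord n → ℝ}
    (hu : ∀ i, SmoothIn D T (u i)) : SmoothIn D T (fun y => ∑ i ∈ s, u i y) :=
  fun z hz => ContDiffWithinAt.sum fun i _ => hu i z hz

theorem SmoothIn.prod {ι : Type*} {s : Finset ι} {u : ι → Coord n → ℝ}
    (hu : ∀ i, SmoothIn D T (u i)) : SmoothIn D T (fun y => ∏ i ∈ s, u i y) :=
  fun z hz => contDiffWithinAt_prod fun i _ => hu i z hz

theorem SmoothIn.inv (hu : SmoothIn D T u) (h0 : ∀ z ∈ T, u z ≠ 0) :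
    SmoothIn D T (fun y => (u y)⁻¹) := fun z hz => (hu z hz).inv (h0 z hz)

theorem SmoothIn.differentiableWithinAt (hu : SmoothIn D T u) (hz : z ∈ T) :
    DifferentiableWithinAt ℝ u D z := (hu z hz).differentiableWithinAt (by simp)

theorem SmoothIn.pd (hT : IsChartDomain D T) (hu : SmoothIn D T u) (k : Fin n) :
    SmoothIn D T (pd D k u) := fun z hz =>
  ((hu z hz).fderivWithin_right hT.uniqueDiffOn (m := ∞) (by simp) (hT.subset hz)).clm_apply
    contDiffWithinAt_const

theorem pd_congr (hT : IsChartDomain D T) (h : ∀ y ∈ T, u y = v y) (hz : z ∈ T) (k : Fin n) :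
    pd D k u z = pd D k v z := by
  unfold pd
  rw [Filter.EventuallyEq.fderivWithin_eq
    (Filter.mem_of_superset (hT.mem_nhdsWithin z hz) h) (h z hz)]

theorem pd_const (c : ℝ) : pd D k (fun _ => c) z = 0 := by simp [pd]

theorem pd_add (hT : IsChartDomain D T) (hu : SmoothIn D T u) (hv : SmoothIn D T v) (hz : z ∈ T) :
    pd D k (fun y => u y + v y) z = pd D k u z + pd D k v z := by
  unfold pd
  rw [fderivWithin_fun_add (hT.uniqueDiffOn z (hT.subset hz)) (hu.differentiableWithinAt hz)
    (hv.differentiableWithinAt hz)]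
  rfl

theorem pd_sub (hT : IsChartDomain D T) (hu : SmoothIn D T u) (hv : SmoothIn D T v) (hz : z ∈ T) :
    pd D k (fun y => u y - v y) z = pd D k u z - pd D k v z := by
  unfold pd
  rw [fderivWithin_fun_sub (hT.uniqueDiffOn z (hT.subset hz)) (hu.differentiableWithinAt hz)
    (hv.differentiableWithinAt hz)]
  rfl

theorem pd_neg (hT : IsChartDomain D T) (hz : z ∈ T) :
    pd D k (fun y => -u y) z = -pd D k u z := by
  unfold pd
  rw [fderivWithin_fun_neg (hT.uniqueDiffOn z (hT.subset hz))]
  rfl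

theorem pd_mul (hT : IsChartDomain D T) (hu : SmoothIn D T u) (hv : SmoothIn D T v) (hz : z ∈ T) :
    pd D k (fun y => u y * v y) z = pd D k u z * v z + u z * pd D k v z := by
  unfold pd
  rw [fderivWithin_fun_mul (hT.uniqueDiffOn z (hT.subset hz)) (hu.differentiableWithinAt hz)
    (hv.differentiableWithinAt hz)]
  simp only [add_apply, smul_apply, smul_eq_mul]
  ring

theorem pd_div_const (hT : IsChartDomain D T) (hu : SmoothIn D T u) (hz : z ∈ T) (c : ℝ) :
    pd D k (fun y => u y / c) z = pd D k u z / c := by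
  simp only [div_eq_mul_inv]
  rw [pd_mul hT hu (SmoothIn.const _) hz, pd_const]
  ring

theorem pd_sum {ι : Type*} {s : Finset ι} {u : ι → Coord n → ℝ} (hT : IsChartDomain D T)
    (hu : ∀ i, SmoothIn D T (u i)) (hz : z ∈ T) :
    pd D k (fun y => ∑ i ∈ s, u i y) z = ∑ i ∈ s, pd D k (u i) z := by
  unfold pd
  rw [fderivWithin_fun_sum (hT.uniqueDiffOn z (hT.subset hz))
    (fun i _ => (hu i).differentiableWithinAt hz)]
  simp

theorem pd_sum_mul {ι : Type*} {s : Finset ι} {u v : ι → Coord n → ℝ} (hT : IsChartDomain D T)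
    (hu : ∀ i, SmoothIn D T (u i)) (hv : ∀ i, SmoothIn D T (v i)) (hz : z ∈ T) :
    pd D k (fun y => ∑ i ∈ s, u i y * v i y) z
      = ∑ i ∈ s, (pd D k (u i) z * v i z + u i z * pd D k (v i) z) := by
  rw [pd_sum hT (fun i => (hu i).mul (hv i)) hz]
  exact Finset.sum_congr rfl fun i _ => pd_mul hT (hu i) (hv i) hz

theorem two_le_infty : (2 : ℕ∞ω) ≤ ∞ :=
  WithTop.coe_le_coe.2 (le_top (a := (2 : ℕ∞)))

/-- Symmetry of second derivatives within `D` at a boundary point holds because the point is a limit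
of interior points of `D`. This is the purpose of the field `subset_closure`. -/
theorem pd_pd_comm (hT : IsChartDomain D T) (hu : SmoothIn D T u) (hz : z ∈ T) (i j : Fin n) :
    pd D i (pd D j u) z = pd D j (pd D i u) z := by
  have hs : IsSymmSndFDerivWithinAt ℝ u D z :=
    (hu z hz).isSymmSndFDerivWithinAt (by simpa using two_le_infty) hT.uniqueDiffOn (hT.subset_closure hz)
      (hT.subset hz)
  have hd : DifferentiableWithinAt ℝ (fderivWithin ℝ u D) D z :=
    ((hu z hz).fderivWithin_right hT.uniqueDiffOn (m := 1) (by norm_cast)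
      (hT.subset hz)).differentiableWithinAt one_ne_zero
  have key : ∀ a b : Fin n, pd D a (pd D b u) z
      = fderivWithin ℝ (fderivWithin ℝ u D) D z (EuclideanSpace.single a 1)
          (EuclideanSpace.single b 1) := by
    intro a b
    unfold pd
    rw [fderivWithin_clm_apply (hT.uniqueDiffOn z (hT.subset hz)) hd
      (differentiableWithinAt_const _)]
    simp
  rw [key, key]
  exact hs.eq _ _

/-- The chain rule for a map `f` into a chart domain. -/
theorem pd_comp {m : ℕ} {D' T' : Set (Coord m)} (hT : IsChartDomain D T) {f : Coord n → Coord m}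
    (hf : ∀ a, SmoothIn D T (fun y => f y a)) (hfT : ∀ y ∈ T, f y ∈ T')
    (hfD : ∀ y ∈ T', y ∈ D') {w : Coord m → ℝ} (hw : SmoothIn D' T' w) (hz : z ∈ T) (k : Fin n) :
    pd D k (fun y => w (f y)) z
      = ∑ c, pd D' c w (f z) * pd D k (fun y => f y c) z := by
  have hfd : DifferentiableWithinAt ℝ f D z := by
    rw [differentiableWithinAt_euclidean]
    exact fun a => (hf a).differentiableWithinAt hz
  have hu := hT.uniqueDiffOn z (hT.subset hz)
  -- The function `w` is differentiable only within `D'`, and `f` is known to land in `D'` only on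
  -- `T`. The chain rule is therefore applied on `T` and then extended to `D`, because `T` is a
  -- neighbourhood within `D`.
  have h1 : HasFDerivWithinAt w (fderivWithin ℝ w D' (f z)) (f '' T) (f z) :=
    ((hw.differentiableWithinAt (hfT z hz)).hasFDerivWithinAt).mono
      (by rintro _ ⟨y, hy, rfl⟩; exact hfD _ (hfT y hy))
  have h2 := (h1.comp z ((hfd.hasFDerivWithinAt).mono hT.subset) (Set.mapsTo_image f T))
  have h3 : HasFDerivWithinAt (w ∘ f) ((fderivWithin ℝ w D' (f z)).comp (fderivWithin ℝ f D z))
      D z := h2.mono_of_mem_nhdsWithin (hT.mem_nhdsWithin z hz)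
  have h4 : ∀ c, pd D k (fun y => f y c) z
      = (fderivWithin ℝ f D z (EuclideanSpace.single k 1)) c := by
    intro c
    have := ((EuclideanSpace.proj (𝕜 := ℝ) c).hasFDerivAt.comp_hasFDerivWithinAt z
      hfd.hasFDerivWithinAt)
    unfold pd
    rw [show (fun y => f y c) = (EuclideanSpace.proj (𝕜 := ℝ) c) ∘ f from rfl,
      this.fderivWithin hu]
    rfl
  have h5 : pd D k (fun y => w (f y)) z
      = fderivWithin ℝ w D' (f z) (fderivWithin ℝ f D z (EuclideanSpace.single k 1)) := by
    unfold pd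
    rw [show (fun y => w (f y)) = w ∘ f from rfl, h3.fderivWithin hu]
    rfl
  rw [h5]
  simp only [h4]
  generalize fderivWithin ℝ f D z (EuclideanSpace.single k 1) = V
  have hV : V = ∑ c, V c • EuclideanSpace.single c (1 : ℝ) := by
    ext a
    simp [Finset.sum_apply, Pi.single_apply]
  conv_lhs => rw [hV]
  simp only [map_sum, map_smul, smul_eq_mul, pd]
  exact Finset.sum_congr rfl fun c _ => mul_comm _ _

theorem SmoothIn.comp {m : ℕ} {D' T' : Set (Coord m)} (hT : IsChartDomain D T)
    {f : Coord n → Coord m}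
    (hf : ∀ a, SmoothIn D T (fun y => f y a)) (hfT : ∀ y ∈ T, f y ∈ T')
    (hfD : ∀ y ∈ T', y ∈ D') {w : Coord m → ℝ} (hw : SmoothIn D' T' w) :
    SmoothIn D T (fun y => w (f y)) := by
  intro z hz
  have hfc : ContDiffWithinAt ℝ ∞ f T z := by
    rw [contDiffWithinAt_euclidean]
    exact fun a => (hf a z hz).mono hT.subset
  have h := (hw (f z) (hfT z hz)).comp z hfc (fun y hy => hfD _ (hfT y hy))
  exact h.mono_of_mem_nhdsWithin (hT.mem_nhdsWithin z hz)

end Calculus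

/-! ### Metrics, Christoffel symbols and curvature in coordinates -/

/-- `g` is a smooth nondegenerate symmetric bilinear form on `T`. -/
structure IsMetricOn {n : ℕ} (D T : Set (Coord n)) (g : TwoTensor n) : Prop where
  smooth : ∀ i j, SmoothIn D T (fun y => g y i j)
  symm : ∀ y ∈ T, ∀ i j, g y i j = g y j i
  det_ne_zero : ∀ y ∈ T, (Matrix.of (g y)).det ≠ 0

section Metric

variable {n : ℕ} {D T : Set (Coord n)} {g : TwoTensor n} {z : Coord n}

theorem SmoothIn.det {ι : Type*} [Fintype ι] [DecidableEq ι] {A : Coord n → Matrix ι ι ℝ}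
    (hA : ∀ i j, SmoothIn D T (fun y => A y i j)) : SmoothIn D T (fun y => (A y).det) := by
  simp only [Matrix.det_apply']
  exact SmoothIn.sum fun σ => (SmoothIn.const _).mul (SmoothIn.prod fun i => hA _ _)

/-- Cramer's rule: the entries of the inverse are polynomials in the entries of `g` divided by the
nonvanishing determinant. -/
theorem IsMetricOn.smooth_inv (hg : IsMetricOn D T g) (i j : Fin n) :
    SmoothIn D T (fun y => invMetric g y i j) := by
  have h : (fun y => invMetric g y i j) = fun y => ((Matrix.of (g y)).det)⁻¹ *
      ((Matrix.of (g y)).updateRow j (Pi.single i 1)).det := by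
    ext y
    simp [invMetric, Matrix.inv_def, Matrix.adjugate_apply]
  rw [h]
  refine SmoothIn.mul (SmoothIn.inv (SmoothIn.det fun a b => hg.smooth a b) hg.det_ne_zero)
    (SmoothIn.det fun a b => ?_)
  by_cases ha : a = j
  · subst ha
    simpa using SmoothIn.const _
  · simpa [Matrix.updateRow_ne ha] using hg.smooth a b

theorem IsMetricOn.inv_mul (hg : IsMetricOn D T g) (hz : z ∈ T) (i k : Fin n) :
    ∑ j, invMetric g z i j * g z j k = if i = k then 1 else 0 := by
  have h := Matrix.nonsing_inv_mul (Matrix.of (g z)) (isUnit_iff_ne_zero.2 (hg.det_ne_zero z hz))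
  have := congrFun (congrFun h i) k
  simpa [Matrix.mul_apply, Matrix.one_apply, invMetric] using this

theorem IsMetricOn.mul_inv (hg : IsMetricOn D T g) (hz : z ∈ T) (i k : Fin n) :
    ∑ j, g z i j * invMetric g z j k = if i = k then 1 else 0 := by
  have h := Matrix.mul_nonsing_inv (Matrix.of (g z)) (isUnit_iff_ne_zero.2 (hg.det_ne_zero z hz))
  have := congrFun (congrFun h i) k
  simpa [Matrix.mul_apply, Matrix.one_apply, invMetric] using this

theorem IsMetricOn.inv_symm (hg : IsMetricOn D T g) (hz : z ∈ T) (i j : Fin n) :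
    invMetric g z i j = invMetric g z j i := by
  have h : (Matrix.of (g z)).transpose = Matrix.of (g z) := by
    ext a b
    exact (hg.symm z hz b a)
  have h2 := Matrix.transpose_nonsing_inv (Matrix.of (g z))
  rw [h] at h2
  exact congrFun (congrFun h2 j) i

theorem IsMetricOn.smooth_christoffel (hT : IsChartDomain D T) (hg : IsMetricOn D T g)
    (k i j : Fin n) : SmoothIn D T (fun y => christoffel D g y k i j) :=
  (SmoothIn.const _).mul (SmoothIn.sum fun _ => (hg.smooth_inv _ _).mul
    ((((hg.smooth _ _).pd hT _).add ((hg.smooth _ _).pd hT _)).sub ((hg.smooth _ _).pd hT _)))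

theorem IsMetricOn.pd_symm (hT : IsChartDomain D T) (hg : IsMetricOn D T g) (hz : z ∈ T)
    (k i j : Fin n) : pd D k (fun y => g y i j) z = pd D k (fun y => g y j i) z :=
  pd_congr hT (fun y hy => hg.symm y hy i j) hz k

theorem IsMetricOn.christoffel_symm (hT : IsChartDomain D T) (hg : IsMetricOn D T g) (hz : z ∈ T)
    (k i j : Fin n) : christoffel D g z k i j = christoffel D g z k j i := by
  unfold christoffel
  congr 1
  refine Finset.sum_congr rfl fun l _ => ?_
  rw [hg.pd_symm hT hz l i j]
  ring

/-- The Christoffel symbols of the first kind. -/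
theorem IsMetricOn.sum_mul_christoffel (hg : IsMetricOn D T g) (hz : z ∈ T)
    (k i j : Fin n) : ∑ a, g z k a * christoffel D g z a i j = (1 / 2) *
      (pd D i (fun y => g y j k) z + pd D j (fun y => g y i k) z - pd D k (fun y => g y i j) z) := by
  unfold christoffel
  have h : ∀ F : Fin n → ℝ, ∑ a, g z k a * ((1 / 2) * ∑ l, invMetric g z a l * F l)
      = (1 / 2) * F k := by
    intro F
    calc _ = (1 / 2) * ∑ l, (∑ a, g z k a * invMetric g z a l) * F l := by
          simp only [Finset.mul_sum, Finset.sum_mul]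
          rw [Finset.sum_comm]
          refine Finset.sum_congr rfl fun l _ => Finset.sum_congr rfl fun a _ => by ring
      _ = _ := by simp [hg.mul_inv hz]
  exact h _

/-- Metric compatibility, in coordinates. -/
theorem IsMetricOn.pd_metric (hT : IsChartDomain D T) (hg : IsMetricOn D T g) (hz : z ∈ T)
    (k i j : Fin n) : pd D k (fun y => g y i j) z
      = ∑ a, christoffel D g z a k i * g z a j + ∑ a, christoffel D g z a k j * g z i a := by
  have h1 : ∑ a, christoffel D g z a k i * g z a j = ∑ a, g z j a * christoffel D g z a k i :=
    Finset.sum_congr rfl fun a _ => by rw [hg.symm z hz a j, mul_comm]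
  have h2 : ∑ a, christoffel D g z a k j * g z i a = ∑ a, g z i a * christoffel D g z a k j :=
    Finset.sum_congr rfl fun a _ => mul_comm _ _
  rw [h1, h2, hg.sum_mul_christoffel hz, hg.sum_mul_christoffel hz, hg.pd_symm hT hz k j i,
    hg.pd_symm hT hz i k j, hg.pd_symm hT hz j k i]
  ring

/-- Differentiate g⁻¹g = 1, insert metric compatibility for the derivative of g, and multiply by g⁻¹
from the right. Matrix notation keeps the index sums out of the way. -/
theorem IsMetricOn.pd_invMetric (hT : IsChartDomain D T) (hg : IsMetricOn D T g) (hz : z ∈ T)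
    (k i j : Fin n) : pd D k (fun y => invMetric g y i j) z
      = -∑ a, christoffel D g z i k a * invMetric g z a j
        - ∑ a, christoffel D g z j k a * invMetric g z i a := by
  have key : ∀ b, ∑ a, (pd D k (fun y => invMetric g y i a) z * g z a b
      + invMetric g z i a * pd D k (fun y => g y a b) z) = 0 := by
    intro b
    rw [← pd_sum_mul hT (fun a => hg.smooth_inv i a) (fun a => hg.smooth a b) hz,
      pd_congr hT (fun y hy => hg.inv_mul hy i b) hz, pd_const]
  let dI : Matrix (Fin n) (Fin n) ℝ := Matrix.of fun i j => pd D k (fun y => invMetric g y i j) z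
  let dG : Matrix (Fin n) (Fin n) ℝ := Matrix.of fun i j => pd D k (fun y => g y i j) z
  let Γ : Matrix (Fin n) (Fin n) ℝ := Matrix.of fun a i => christoffel D g z a k i
  let A : Matrix (Fin n) (Fin n) ℝ := Matrix.of (g z)
  have hdet : IsUnit A.det := isUnit_iff_ne_zero.2 (hg.det_ne_zero z hz)
  have h1 : ∀ i b, ∑ a, (pd D k (fun y => invMetric g y i a) z * g z a b
      + invMetric g z i a * pd D k (fun y => g y a b) z) = (dI * A + A⁻¹ * dG) i b := by
    intro i b
    simp [Matrix.mul_apply, Finset.sum_add_distrib, dI, A, dG, invMetric]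
  -- Metric compatibility in matrix form, for the fixed direction `k`.
  have hdG : dG = Γ.transpose * A + A * Γ := by
    ext a b
    simp only [dG, Matrix.of_apply, hg.pd_metric hT hz, Matrix.add_apply, Matrix.mul_apply,
      Matrix.transpose_apply, Γ, A]
    congr 1
    exact Finset.sum_congr rfl fun _ _ => mul_comm _ _
  have hrow : ∀ b, (dI * A + A⁻¹ * dG) i b = 0 := fun b => by rw [← h1, key]
  have hsol : (dI * A + A⁻¹ * dG) * A⁻¹ = dI + A⁻¹ * Γ.transpose + Γ * A⁻¹ := by
    rw [hdG, add_mul, Matrix.mul_nonsing_inv_cancel_right _ _ hdet, mul_add, add_mul,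
      ← Matrix.mul_assoc, Matrix.mul_nonsing_inv_cancel_right _ _ hdet, 
      Matrix.nonsing_inv_mul_cancel_left _ _ hdet, add_assoc]
  have h3 : (dI + A⁻¹ * Γ.transpose + Γ * A⁻¹) i j = 0 := by
    rw [← hsol, Matrix.mul_apply]
    exact Finset.sum_eq_zero fun b _ => by rw [hrow, zero_mul]
  have e1 : (A⁻¹ * Γ.transpose) i j = ∑ a, christoffel D g z j k a * invMetric g z i a := by
    simp only [Matrix.mul_apply, Matrix.transpose_apply, Γ, Matrix.of_apply]
    exact Finset.sum_congr rfl fun _ _ => mul_comm _ _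
  have e2 : (Γ * A⁻¹) i j = ∑ a, christoffel D g z i k a * invMetric g z a j := by
    simp only [Matrix.mul_apply, Γ, Matrix.of_apply]
    rfl
  rw [Matrix.add_apply, Matrix.add_apply, e1, e2] at h3
  change dI i j = _
  linarith

theorem riemannUp_antisymm (D : Set (Coord n)) (g : TwoTensor n) (z : Coord n)
    (i j k l : Fin n) : riemannUp D g z i j k l = -riemannUp D g z j i k l := by
  unfold riemannUp
  rw [neg_add, neg_sub, ← Finset.sum_neg_distrib]
  congr 1
  exact Finset.sum_congr rfl fun _ _ => by ring

theorem riemann_antisymm (D : Set (Coord n)) (g : TwoTensor n) (z : Coord n)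
    (i j k l : Fin n) : riemann D g z i j k l = -riemann D g z j i k l := by
  unfold riemann
  rw [← Finset.sum_neg_distrib]
  exact Finset.sum_congr rfl fun _ _ => by rw [riemannUp_antisymm]; ring

theorem IsMetricOn.riemannUp_bianchi (hT : IsChartDomain D T) (hg : IsMetricOn D T g)
    (hz : z ∈ T) (i j k l : Fin n) :
    riemannUp D g z i j k l + riemannUp D g z j k i l + riemannUp D g z k i j l = 0 := by
  unfold riemannUp
  have hp : ∀ a i j k, pd D k (fun y => christoffel D g y a i j) z
      = pd D k (fun y => christoffel D g y a j i) z := fun a i j k =>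
    pd_congr hT (fun y hy => hg.christoffel_symm hT hy a i j) hz k
  have hs : (∑ a, (christoffel D g z l i a * christoffel D g z a j k
      - christoffel D g z l j a * christoffel D g z a i k))
      + (∑ a, (christoffel D g z l j a * christoffel D g z a k i
      - christoffel D g z l k a * christoffel D g z a j i))
      + (∑ a, (christoffel D g z l k a * christoffel D g z a i j
      - christoffel D g z l i a * christoffel D g z a k j)) = 0 := by
    rw [← Finset.sum_add_distrib, ← Finset.sum_add_distrib]
    refine Finset.sum_eq_zero fun a _ => ?_
    rw [hg.christoffel_symm hT hz a k j, hg.christoffel_symm hT hz a k i,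
      hg.christoffel_symm hT hz a j i]
    ring
  rw [hp l k j, hp l k i, hp l j i]
  linarith

theorem IsMetricOn.riemann_bianchi (hT : IsChartDomain D T) (hg : IsMetricOn D T g)
    (hz : z ∈ T) (i j k l : Fin n) :
    riemann D g z i j k l + riemann D g z j k i l + riemann D g z k i j l = 0 := by
  unfold riemann
  rw [← Finset.sum_add_distrib, ← Finset.sum_add_distrib]
  refine Finset.sum_eq_zero fun a _ => ?_
  rw [← add_mul, ← add_mul, hg.riemannUp_bianchi hT hz, zero_mul]

/-- The second derivatives of the metric commute. Writing the first derivative as ΓᵀA + AΓ and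
differentiating again turns this into ΩᵀA + AΩ = 0 for the curvature matrix Ω, which says that AΩ is
antisymmetric. -/
theorem IsMetricOn.riemann_antisymm_right (hT : IsChartDomain D T) (hg : IsMetricOn D T g)
    (hz : z ∈ T) (i j k l : Fin n) :
    riemann D g z i j k l = -riemann D g z i j l k := by
  let A : Matrix (Fin n) (Fin n) ℝ := Matrix.of (g z)
  let Γ : Fin n → Matrix (Fin n) (Fin n) ℝ := fun k => Matrix.of fun a i => christoffel D g z a k i
  let dΓ : Fin n → Fin n → Matrix (Fin n) (Fin n) ℝ := fun m k =>
    Matrix.of fun a i => pd D m (fun y => christoffel D g y a k i) z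
  let dA : Fin n → Matrix (Fin n) (Fin n) ℝ := fun k => Matrix.of fun i j =>
    pd D k (fun y => g y i j) z
  let ddA : Fin n → Fin n → Matrix (Fin n) (Fin n) ℝ := fun m k => Matrix.of fun i j =>
    pd D m (pd D k (fun y => g y i j)) z
  let Ω : Fin n → Fin n → Matrix (Fin n) (Fin n) ℝ := fun i j =>
    dΓ i j - dΓ j i + (Γ i * Γ j - Γ j * Γ i)
  have hAs : A.transpose = A := by ext a b; exact hg.symm z hz b a
  have hR : ∀ i j k l, riemann D g z i j k l = (A * Ω i j) l k := by
    intro i j k l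
    rw [Matrix.mul_apply]
    refine Finset.sum_congr rfl fun a _ => ?_
    rw [mul_comm]
    congr 1
    · exact hg.symm z hz a l
    · simp [Ω, dΓ, Γ, riemannUp, Matrix.mul_apply, Finset.sum_sub_distrib]
  have hdA : ∀ k, dA k = (Γ k).transpose * A + A * Γ k := by
    intro k
    ext a b
    simp only [dA, Matrix.of_apply, hg.pd_metric hT hz, Matrix.add_apply, Matrix.mul_apply,
      Matrix.transpose_apply, Γ, A]
    congr 1
    exact Finset.sum_congr rfl fun _ _ => mul_comm _ _
  have hddA : ∀ m k, ddA m k = (dΓ m k).transpose * A + (Γ k).transpose * dA m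
      + dA m * Γ k + A * dΓ m k := by
    intro m k
    ext a b
    have hc := fun a i => hg.smooth_christoffel hT a k i
    simp only [ddA, Matrix.of_apply]
    rw [pd_congr hT (fun y hy => hg.pd_metric hT hy k a b) hz,
      pd_add hT (SmoothIn.sum fun _ => (hc _ _).mul (hg.smooth _ _))
        (SmoothIn.sum fun _ => (hc _ _).mul (hg.smooth _ _)) hz,
      pd_sum_mul hT (fun i => hc i _) (fun i => hg.smooth i _) hz,
      pd_sum_mul hT (fun i => hc i _) (fun i => hg.smooth _ i) hz]
    simp only [Finset.sum_add_distrib, Matrix.add_apply, Matrix.mul_apply,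
      Matrix.transpose_apply, dΓ, Γ, dA, A, Matrix.of_apply]
    have e : ∀ u v : Fin n → ℝ, ∑ i, u i * v i = ∑ i, v i * u i := fun u v =>
      Finset.sum_congr rfl fun _ _ => mul_comm _ _
    rw [e (fun i => pd D m (fun y => christoffel D g y i k b) z),
      e (fun i => christoffel D g z i k b)]
    ring
  have hsym : ddA i j = ddA j i := by
    ext a b
    exact pd_pd_comm hT (hg.smooth a b) hz i j
  -- The mixed terms Γᵢᵀ A Γⱼ + Γⱼᵀ A Γᵢ are symmetric in i and j and drop out of the difference.
  have hΩ : (Ω i j).transpose * A + A * Ω i j = 0 := by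
    rw [hddA, hddA, hdA, hdA] at hsym
    simp only [Ω, Matrix.transpose_add, Matrix.transpose_sub, Matrix.transpose_mul]
    have := sub_eq_zero.2 hsym
    rw [← this]
    noncomm_ring
  have h := congrFun (congrFun hΩ l) k
  have h' : ((Ω i j).transpose * A) l k = (A * Ω i j) k l := by
    rw [← Matrix.transpose_apply (A * Ω i j), Matrix.transpose_mul, hAs]
  rw [hR, hR]
  simp only [Matrix.add_apply, h', Matrix.zero_apply] at h
  linarith

/-- The classical octahedron argument: the four Bianchi identities with one index held last combine
linearly with the two antisymmetries. -/
theorem IsMetricOn.riemann_pair_symm (hT : IsChartDomain D T) (hg : IsMetricOn D T g)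
    (hz : z ∈ T) (i j k l : Fin n) :
    riemann D g z i j k l = riemann D g z k l i j := by
  have b := hg.riemann_bianchi hT hz
  have r := hg.riemann_antisymm_right hT hz
  have s := riemann_antisymm D g z
  linarith [b i j k l, b j k l i, b k l i j, b l i j k, r i j k l, r j k i l, r k i j l,
    r j k l i, r k l j i, r l j k i, r k l i j, r l i k j, r i k l j, r l i j k, r i j l k,
    r j l i k, s i j k l, s k l i j, s j l i k, s i k l j, s k i j l, s l j k i, s k i l j,
    s l j i k]

/-- `R_{ijk}^l` recovered from `R_{ijka}`. -/
theorem IsMetricOn.riemannUp_eq (hg : IsMetricOn D T g) (hz : z ∈ T) (i j k l : Fin n) :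
    riemannUp D g z i j k l = ∑ a, invMetric g z l a * riemann D g z i j k a := by
  unfold riemann
  simp only [Finset.mul_sum]
  rw [Finset.sum_comm]
  have : ∀ b, ∑ a, invMetric g z l a * (riemannUp D g z i j k b * g z b a)
      = riemannUp D g z i j k b * if l = b then 1 else 0 := by
    intro b
    rw [← hg.inv_mul hz l b, Finset.mul_sum]
    exact Finset.sum_congr rfl fun a _ => by rw [hg.symm z hz b a]; ring
  simp [this]

theorem IsMetricOn.ricci_eq (hg : IsMetricOn D T g) (hz : z ∈ T) (j k : Fin n) :
    ricci D g z j k = ∑ i, ∑ a, invMetric g z i a * riemann D g z i j k a := by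
  unfold ricci
  exact Finset.sum_congr rfl fun i _ => hg.riemannUp_eq hz i j k i

end Metric

/-! ### Covariant derivatives: locality, Leibniz rules and the Ricci identity -/

section Covariant

variable {n : ℕ} {D T : Set (Coord n)} {g : TwoTensor n} {z : Coord n}

theorem nabla3_congr (hT : IsChartDomain D T) {s t : ThreeTensor n}
    (h : ∀ y ∈ T, ∀ k i j, s y k i j = t y k i j) (hz : z ∈ T) (l k i j : Fin n) :
    nabla3 D g s z l k i j = nabla3 D g t z l k i j := by
  unfold nabla3
  rw [pd_congr hT (fun y hy => h y hy k i j) hz]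
  simp only [h z hz]

theorem IsMetricOn.smooth_nabla2 (hT : IsChartDomain D T) (hg : IsMetricOn D T g)
    {b : TwoTensor n} (hb : ∀ i j, SmoothIn D T (fun y => b y i j)) (k i j : Fin n) :
    SmoothIn D T (fun y => nabla2 D g b y k i j) :=
  (((hb _ _).pd hT _).sub (SmoothIn.sum fun _ => (hg.smooth_christoffel hT _ _ _).mul (hb _ _))).sub
    (SmoothIn.sum fun _ => (hg.smooth_christoffel hT _ _ _).mul (hb _ _))

theorem nabla2_sub (hT : IsChartDomain D T) {b c : TwoTensor n}
    (hb : ∀ i j, SmoothIn D T (fun y => b y i j)) (hc : ∀ i j, SmoothIn D T (fun y => c y i j))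
    (hz : z ∈ T) (k i j : Fin n) :
    nabla2 D g (fun y i j => b y i j - c y i j) z k i j
      = nabla2 D g b z k i j - nabla2 D g c z k i j := by
  unfold nabla2
  rw [pd_sub hT (hb i j) (hc i j) hz]
  simp only [mul_sub, Finset.sum_sub_distrib]
  ring

theorem nabla3_add (hT : IsChartDomain D T) {s t : ThreeTensor n}
    (hs : ∀ k i j, SmoothIn D T (fun y => s y k i j))
    (ht : ∀ k i j, SmoothIn D T (fun y => t y k i j)) (hz : z ∈ T) (l k i j : Fin n) :
    nabla3 D g (fun y k i j => s y k i j + t y k i j) z l k i j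
      = nabla3 D g s z l k i j + nabla3 D g t z l k i j := by
  unfold nabla3
  rw [pd_add hT (hs k i j) (ht k i j) hz]
  simp only [mul_add, Finset.sum_add_distrib]
  ring

theorem nabla3_sub (hT : IsChartDomain D T) {s t : ThreeTensor n}
    (hs : ∀ k i j, SmoothIn D T (fun y => s y k i j))
    (ht : ∀ k i j, SmoothIn D T (fun y => t y k i j)) (hz : z ∈ T) (l k i j : Fin n) :
    nabla3 D g (fun y k i j => s y k i j - t y k i j) z l k i j
      = nabla3 D g s z l k i j - nabla3 D g t z l k i j := by
  unfold nabla3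
  rw [pd_sub hT (hs k i j) (ht k i j) hz]
  simp only [mul_sub, Finset.sum_sub_distrib]
  ring

theorem nabla3_div_const (hT : IsChartDomain D T) {s : ThreeTensor n}
    (hs : ∀ k i j, SmoothIn D T (fun y => s y k i j)) (hz : z ∈ T) (c : ℝ) (l k i j : Fin n) :
    nabla3 D g (fun y k i j => s y k i j / c) z l k i j = nabla3 D g s z l k i j / c := by
  unfold nabla3
  rw [pd_div_const hT (hs k i j) hz]
  simp only [← mul_div_assoc, ← Finset.sum_div]
  ring

/-- Covariant differentiation commutes with permuting slots. This is needed for the second term of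
the antisymmetrized derivative of a two-tensor. -/
theorem nabla3_swap (D : Set (Coord n)) (g : TwoTensor n) (t : ThreeTensor n) (z : Coord n)
    (l k i j : Fin n) :
    nabla3 D g (fun y k i j => t y i k j) z l k i j = nabla3 D g t z l i k j := by
  unfold nabla3
  ring

/-- Only the derivative of `u` survives, because ∇g = 0. -/
theorem IsMetricOn.nabla2_smul_metric (hT : IsChartDomain D T) (hg : IsMetricOn D T g)
    {u : Coord n → ℝ} (hu : SmoothIn D T u) (hz : z ∈ T) (k i j : Fin n) :
    nabla2 D g (fun y i j => u y * g y i j) z k i j = pd D k u z * g z i j := by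
  unfold nabla2
  rw [pd_mul hT hu (hg.smooth i j) hz, hg.pd_metric hT hz]
  simp only [mul_add, Finset.mul_sum, mul_left_comm (u z)]
  ring

theorem IsMetricOn.nabla3_mul_metric (hT : IsChartDomain D T) (hg : IsMetricOn D T g)
    {α : OneTensor n} (hα : ∀ i, SmoothIn D T (fun y => α y i)) (hz : z ∈ T) (l k i j : Fin n) :
    nabla3 D g (fun y k i j => α y k * g y i j) z l k i j = nabla1 D g α z l k * g z i j := by
  unfold nabla3 nabla1
  rw [pd_mul hT (hα k) (hg.smooth i j) hz, hg.pd_metric hT hz]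
  simp only [mul_add, Finset.mul_sum, mul_left_comm (α z k), sub_mul, Finset.sum_mul, mul_assoc]
  ring

end Covariant

/-! ### Contractions, Leibniz rules and the Ricci identity in dimension three, by expansion of the
index sums. -/

section CovariantThree

variable {D T : Set (Coord 3)} {g : TwoTensor 3} {z : Coord 3}

/-- Covariant differentiation commutes with the contraction of two indices. -/
theorem IsMetricOn.pd_trace (hT : IsChartDomain D T) (hg : IsMetricOn D T g)
    {b : TwoTensor 3} (hb : ∀ i j, SmoothIn D T (fun y => b y i j)) (hz : z ∈ T) (k : Fin 3) :
    pd D k (trace g b) z = ∑ i, ∑ j, invMetric g z i j * nabla2 D g b z k i j := by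
  unfold trace nabla2
  rw [pd_sum hT (fun i => SmoothIn.sum fun j => (hg.smooth_inv i j).mul (hb i j)) hz]
  simp only [pd_sum_mul hT (hg.smooth_inv _) (hb _) hz, hg.pd_invMetric hT hz]
  simp only [Fin.sum_univ_three]
  ring

/-- The derivative of the inverse metric supplies exactly the Christoffel terms of the two
contracted slots, so ∇ passes under the contraction. -/
theorem IsMetricOn.nabla1_contract_left (hT : IsChartDomain D T) (hg : IsMetricOn D T g)
    {t : ThreeTensor 3} (ht : ∀ k i j, SmoothIn D T (fun y => t y k i j)) (hz : z ∈ T)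
    (l j : Fin 3) :
    nabla1 D g (fun y j => ∑ i, ∑ k, invMetric g y k i * t y k i j) z l j
      = ∑ i, ∑ k, invMetric g z k i * nabla3 D g t z l k i j := by
  unfold nabla1 nabla3
  rw [pd_sum hT (fun i => SmoothIn.sum fun k => (hg.smooth_inv k i).mul (ht k i j)) hz]
  simp only [pd_sum_mul hT (fun k => hg.smooth_inv k _) (fun k => ht k _ j) hz,
    hg.pd_invMetric hT hz]
  simp only [Fin.sum_univ_three]
  ring

theorem IsMetricOn.nabla1_contract_right (hT : IsChartDomain D T) (hg : IsMetricOn D T g)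
    {t : ThreeTensor 3} (ht : ∀ k i j, SmoothIn D T (fun y => t y k i j)) (hz : z ∈ T)
    (l k : Fin 3) :
    nabla1 D g (fun y k => ∑ i, ∑ j, invMetric g y i j * t y k i j) z l k
      = ∑ i, ∑ j, invMetric g z i j * nabla3 D g t z l k i j := by
  unfold nabla1 nabla3
  rw [pd_sum hT (fun i => SmoothIn.sum fun j => (hg.smooth_inv i j).mul (ht k i j)) hz]
  simp only [pd_sum_mul hT (hg.smooth_inv _) (fun j => ht k _ j) hz,
    hg.pd_invMetric hT hz]
  simp only [Fin.sum_univ_three]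
  ring

theorem IsMetricOn.nabla2_square (hT : IsChartDomain D T) (hg : IsMetricOn D T g)
    {b : TwoTensor 3} (hb : ∀ i j, SmoothIn D T (fun y => b y i j)) (hz : z ∈ T) (m i j : Fin 3) :
    nabla2 D g (square g b) z m i j
      = (∑ k, ∑ l, invMetric g z l k * (nabla2 D g b z m i l * b z k j))
        + ∑ k, ∑ l, invMetric g z l k * (b z i l * nabla2 D g b z m k j) := by
  unfold nabla2 square
  rw [pd_sum hT (fun k => SmoothIn.sum fun l =>
    ((hg.smooth_inv l k).mul (hb i l)).mul (hb k j)) hz]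
  simp only [pd_sum hT (fun l => ((hg.smooth_inv l _).mul (hb i l)).mul (hb _ j)) hz,
    pd_mul hT ((hg.smooth_inv _ _).mul (hb i _)) (hb _ j) hz,
    pd_mul hT (hg.smooth_inv _ _) (hb i _) hz, hg.pd_invMetric hT hz]
  simp only [Fin.sum_univ_three]
  ring

theorem IsMetricOn.nabla3_mul_right (hT : IsChartDomain D T) (hg : IsMetricOn D T g)
    {b : TwoTensor 3} (hb : ∀ i j, SmoothIn D T (fun y => b y i j))
    {t : ThreeTensor 3} (ht : ∀ k i j, SmoothIn D T (fun y => t y k i j))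
    (hz : z ∈ T) (p m i j : Fin 3) :
    nabla3 D g (fun y m i j => ∑ k, ∑ l, invMetric g y l k * (t y m i l * b y k j)) z p m i j
      = ∑ k, ∑ l, invMetric g z l k * (nabla3 D g t z p m i l * b z k j
        + t z m i l * nabla2 D g b z p k j) := by
  unfold nabla2 nabla3
  rw [pd_sum hT (fun k => SmoothIn.sum fun l =>
    (hg.smooth_inv l k).mul ((ht m i l).mul (hb k j))) hz]
  simp only [pd_sum hT (fun l => (hg.smooth_inv l _).mul ((ht m i l).mul (hb _ j))) hz,
    pd_mul hT (hg.smooth_inv _ _) ((ht m i _).mul (hb _ j)) hz,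
    pd_mul hT (ht m i _) (hb _ j) hz, hg.pd_invMetric hT hz]
  simp only [Fin.sum_univ_three]
  ring

theorem IsMetricOn.nabla3_mul_left (hT : IsChartDomain D T) (hg : IsMetricOn D T g)
    {b : TwoTensor 3} (hb : ∀ i j, SmoothIn D T (fun y => b y i j))
    {t : ThreeTensor 3} (ht : ∀ k i j, SmoothIn D T (fun y => t y k i j))
    (hz : z ∈ T) (p m i j : Fin 3) :
    nabla3 D g (fun y m i j => ∑ k, ∑ l, invMetric g y l k * (b y i l * t y m k j)) z p m i j
      = ∑ k, ∑ l, invMetric g z l k * (nabla2 D g b z p i l * t z m k j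
        + b z i l * nabla3 D g t z p m k j) := by
  unfold nabla2 nabla3
  rw [pd_sum hT (fun k => SmoothIn.sum fun l =>
    (hg.smooth_inv l k).mul ((hb i l).mul (ht m k j))) hz]
  simp only [pd_sum hT (fun l => (hg.smooth_inv l _).mul ((hb i l).mul (ht m _ j))) hz,
    pd_mul hT (hg.smooth_inv _ _) ((hb i _).mul (ht m _ j)) hz,
    pd_mul hT (hb i _) (ht m _ j) hz, hg.pd_invMetric hT hz]
  simp only [Fin.sum_univ_three]
  ring

/-- The Ricci identity for symmetric two-tensors. -/
theorem IsMetricOn.ricci_identity (hT : IsChartDomain D T) (hg : IsMetricOn D T g)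
    {b : TwoTensor 3} (hb : ∀ i j, SmoothIn D T (fun y => b y i j))
    (hz : z ∈ T) (l k i j : Fin 3) :
    nabla3 D g (nabla2 D g b) z l k i j - nabla3 D g (nabla2 D g b) z k l i j
      = -(∑ a, riemannUp D g z l k i a * b z a j) - ∑ a, riemannUp D g z l k j a * b z i a := by
  have hc := hg.smooth_christoffel hT
  have hpd : ∀ l k, pd D l (fun y => nabla2 D g b y k i j) z
      = pd D l (pd D k (fun y => b y i j)) z
        - ∑ a, (pd D l (fun y => christoffel D g y a k i) z * b z a j
          + christoffel D g z a k i * pd D l (fun y => b y a j) z)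
        - ∑ a, (pd D l (fun y => christoffel D g y a k j) z * b z i a
          + christoffel D g z a k j * pd D l (fun y => b y i a) z) := by
    intro l k
    unfold nabla2
    rw [pd_sub hT (((hb i j).pd hT k).sub (SmoothIn.sum fun a => (hc a k i).mul (hb a j)))
      (SmoothIn.sum fun a => (hc a k j).mul (hb i a)) hz,
      pd_sub hT ((hb i j).pd hT k) (SmoothIn.sum fun a => (hc a k i).mul (hb a j)) hz,
      pd_sum_mul hT (fun a => hc a k i) (fun a => hb a j) hz,
      pd_sum_mul hT (fun a => hc a k j) (fun a => hb i a) hz]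
  -- Symmetry in the lower indices removes the torsion term, in which the commutator would contain a
  -- first derivative of `b`.
  have hsym : ∀ a, christoffel D g z a k l = christoffel D g z a l k :=
    fun a => hg.christoffel_symm hT hz a k l
  unfold nabla3
  rw [hpd, hpd, pd_pd_comm hT (hb i j) hz l k]
  unfold nabla2 riemannUp
  simp only [Fin.sum_univ_three, hsym]
  ring

end CovariantThree

/-! ### The algebra at a point, in an orthonormal frame of a three-dimensional space -/

section Orthonormal

/-- In dimension three the curvature is determined by the Ricci tensor; this is the resulting
formula for the curvature term of the commutator `A^{ij} [∇^k, ∇_i] A_{kj}`. -/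
theorem curvature_term_dim_three {A : Fin 3 → Fin 3 → ℝ} {R : Fin 3 → Fin 3 → Fin 3 → Fin 3 → ℝ}
    (hA : ∀ i j, A i j = A j i) (hA0 : ∑ i, A i i = 0)
    (hR1 : ∀ i j k l, R i j k l = -R j i k l) (hR2 : ∀ i j k l, R i j k l = -R i j l k)
    (hR3 : ∀ i j k l, R i j k l = R k l i j) :
    ∑ i, ∑ j, ∑ k, A i j * (-(∑ a, R k i k a * A a j) - ∑ a, R k i j a * A k a)
      = 3 * ∑ i, ∑ j, ((∑ a, R a i j a) * ∑ c, A i c * A c j)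
        - 2 * ((∑ i, ∑ a, R a i i a) / 4) * ∑ i, ∑ j, A i j * A i j := by
  have z1 : ∀ i k l, R i i k l = 0 := fun i k l => by linarith [hR1 i i k l]
  have z2 : ∀ i j k, R i j k k = 0 := fun i j k => by linarith [hR2 i j k k]
  have l1 := hR1 1 0
  have l2 := hR1 2 0
  have l3 := hR1 2 1
  have r1 := fun i j => hR2 i j 1 0
  have r2 := fun i j => hR2 i j 2 0
  have r3 := fun i j => hR2 i j 2 1
  have p1 := hR3 0 2 0 1
  have p2 := hR3 1 2 0 1
  have p3 := hR3 1 2 0 2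
  have a1 := hA 1 0
  have a2 := hA 2 0
  have a3 := hA 2 1
  -- Trace-freeness is essential here: for A the identity the left side vanishes, while the right
  -- side is 3/2 of the scalar curvature. After this elimination only independent components of A
  -- and R remain.
  have a4 : A 2 2 = -A 0 0 - A 1 1 := by
    simp only [Fin.sum_univ_three] at hA0
    linarith
  simp only [Fin.sum_univ_three, z1, z2, l1, l2, l3, r1, r2, r3, p1, p2, p3, a1, a2, a3, a4]
  ring

variable {A : Fin 3 → Fin 3 → ℝ} {B : Fin 3 → Fin 3 → Fin 3 → ℝ}
  {C : Fin 3 → Fin 3 → Fin 3 → Fin 3 → ℝ}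

/-- The norm of the trace-free part of an antisymmetrized derivative. -/
theorem norm_sq_codazzi (hB : ∀ k i j, B k i j = B k j i) (hB0 : ∀ k, ∑ i, B k i i = 0)
    {d : Fin 3 → ℝ} (hd : ∀ j, d j = ∑ a, B a a j) {W : Fin 3 → Fin 3 → Fin 3 → ℝ}
    (hW : ∀ k i j, W k i j = -(B k i j - B i k j)
      + (d i * (if k = j then 1 else 0) - d k * (if i = j then 1 else 0)) / 2) :
    ∑ i, ∑ j, ∑ k, W i j k * W i j k = 2 * ∑ i, ∑ j, ∑ k, B i j k * B i j k
      - 2 * ∑ i, ∑ j, ∑ k, B i j k * B j i k - ∑ i, d i * d i := by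
  have h0 := hB0 0
  have h1 := hB0 1
  have h2 := hB0 2
  have b1 := fun k => hB k 1 0
  have b2 := fun k => hB k 2 0
  have b3 := fun k => hB k 2 1
  simp only [Fin.sum_univ_three] at h0 h1 h2
  have e0 : B 0 2 2 = -B 0 0 0 - B 0 1 1 := by linarith
  have e1 : B 1 2 2 = -B 1 0 0 - B 1 1 1 := by linarith
  have e2 : B 2 2 2 = -B 2 0 0 - B 2 1 1 := by linarith
  simp only [hW, hd, Fin.sum_univ_three, b1, b2, b3, e0, e1, e2, Fin.isValue, Fin.reduceEq,
    if_true, if_false]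
  ring

/-- The Leibniz expansion `N` of ∇∇(A²) is contracted twice. The two terms with second derivatives
of A differ only in the order of differentiation. The trace of A² is |A|², whose Laplacian produces
the two terms with factor 2/3. -/
theorem double_divergence_square (hA : ∀ i j, A i j = A j i)
    (hB : ∀ k i j, B k i j = B k j i) (hC : ∀ l k i j, C l k i j = C l k j i)
    {N : Fin 3 → Fin 3 → Fin 3 → Fin 3 → ℝ}
    (hN : ∀ p m i j, N p m i j = ∑ c, (C p m i c * A c j + B m i c * B p c j
      + (B p i c * B m c j + A i c * C p m c j))) :
    ∑ i, ∑ a, (N i a a i - (∑ b, N i a b b) / 3 * (if a = i then 1 else 0))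
      = (∑ i, ∑ j, A i j * ∑ k, C k i k j) + (∑ i, ∑ j, A i j * ∑ k, C i k k j)
        + (∑ j, (∑ a, B a a j) * (∑ a, B a a j)) + (∑ i, ∑ j, ∑ k, B i j k * B j i k)
        - (2 / 3) * (∑ i, ∑ j, A i j * ∑ k, C k k i j)
        - (2 / 3) * ∑ i, ∑ j, ∑ k, B i j k * B i j k := by
  have b1 := fun k => hB k 1 0
  have b2 := fun k => hB k 2 0
  have b3 := fun k => hB k 2 1
  have c1 := fun k l => hC k l 1 0
  have c2 := fun k l => hC k l 2 0
  have c3 := fun k l => hC k l 2 1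
  have a1 := hA 1 0
  have a2 := hA 2 0
  have a3 := hA 2 1
  simp only [hN, Fin.sum_univ_three, b1, b2, b3, c1, c2, c3, a1, a2, a3, Fin.isValue, Fin.reduceEq,
    if_true, if_false]
  ring

/-- Pure algebra at a point. `B`, `C`, `N` and `DW` stand for ∇A, ∇∇A, ∇∇(A²) and ∇W, and all
geometry is contained in the relations assumed between them: the Ricci identity `hCR`, the Codazzi
relation `hW` and its derivative `hDW`. -/
theorem orthonormal_identity (hA : ∀ i j, A i j = A j i) (hA0 : ∑ i, A i i = 0)
    (hB : ∀ k i j, B k i j = B k j i) (hB0 : ∀ k, ∑ i, B k i i = 0)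
    (hC : ∀ l k i j, C l k i j = C l k j i)
    {R : Fin 3 → Fin 3 → Fin 3 → Fin 3 → ℝ}
    (hR1 : ∀ i j k l, R i j k l = -R j i k l) (hR2 : ∀ i j k l, R i j k l = -R i j l k)
    (hR3 : ∀ i j k l, R i j k l = R k l i j)
    (hCR : ∀ l k i j, C l k i j - C k l i j
      = -(∑ a, R l k i a * A a j) - ∑ a, R l k j a * A i a)
    {N : Fin 3 → Fin 3 → Fin 3 → Fin 3 → ℝ}
    (hN : ∀ p m i j, N p m i j = ∑ c, (C p m i c * A c j + B m i c * B p c j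
      + (B p i c * B m c j + A i c * C p m c j)))
    {d : Fin 3 → ℝ} (hd : ∀ j, d j = ∑ a, B a a j) {W : Fin 3 → Fin 3 → Fin 3 → ℝ}
    (hW : ∀ k i j, W k i j = -(B k i j - B i k j)
      + (d i * (if k = j then 1 else 0) - d k * (if i = j then 1 else 0)) / 2)
    {DW : Fin 3 → Fin 3 → Fin 3 → Fin 3 → ℝ}
    (hDW : ∀ l k i j, DW l k i j = -(C l k i j - C l i k j)
      + ((∑ a, C l a a i) * (if k = j then 1 else 0)
        - (∑ a, C l a a k) * (if i = j then 1 else 0)) / 2)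
    {J : ℝ} (hJ : J = (∑ i, ∑ a, R a i i a) / 4)
    {P : Fin 3 → Fin 3 → ℝ}
    (hP : ∀ i j, P i j = (∑ a, R a i j a) - J * (if i = j then 1 else 0))
    {S : Fin 3 → Fin 3 → ℝ}
    (hS : ∀ i j, S i j = (∑ c, A i c * A c j)
      - (∑ a, ∑ c, A a c * A c a) / 3 * (if i = j then 1 else 0)) :
    ∑ i, ∑ a, (N i a a i - (∑ b, N i a b b) / 3 * (if a = i then 1 else 0))
        + ∑ i, ∑ j, P i j * S i j
      = (2 / 3) * (∑ i, ∑ j, A i j * ∑ k, C k k i j)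
        + (1 / 3) * (∑ i, ∑ j, ∑ k, B i j k * B i j k)
        + (1 / 2) * (∑ i, d i * d i)
        - (2 / 3) * J * (∑ i, ∑ j, A i j * A i j)
        + (4 / 3) * (∑ i, ∑ j, A i j * ∑ k, DW k k i j)
        - (1 / 2) * ∑ i, ∑ j, ∑ k, W i j k * W i j k := by
  rw [double_divergence_square hA hB hC hN, norm_sq_codazzi hB hB0 hd hW]
  have hcurv := curvature_term_dim_three hA hA0 hR1 hR2 hR3
  have hcomm : (∑ i, ∑ j, A i j * ∑ k, C k i k j) - (∑ i, ∑ j, A i j * ∑ k, C i k k j)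
      = ∑ i, ∑ j, ∑ k, A i j * (-(∑ a, R k i k a * A a j) - ∑ a, R k i j a * A k a) := by
    rw [← Finset.sum_sub_distrib]
    refine Finset.sum_congr rfl fun i _ => ?_
    rw [← Finset.sum_sub_distrib]
    refine Finset.sum_congr rfl fun j _ => ?_
    rw [← mul_sub, ← Finset.sum_sub_distrib, Finset.mul_sum]
    exact Finset.sum_congr rfl fun k _ => by rw [hCR]
  -- The J part of P pairs to zero with the trace-free S. The constant 4/3 is the scalar curvature
  -- 4J times the factor 1/3 in S.
  have hPS : ∑ i, ∑ j, P i j * S i j = ∑ i, ∑ j, ((∑ a, R a i j a) * ∑ c, A i c * A c j)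
      - (4 / 3) * J * ∑ i, ∑ j, A i j * A i j := by
    have hJ' : ∑ i, ∑ a, R a i i a = 4 * J := by rw [hJ]; ring
    have a1 := hA 1 0
    have a2 := hA 2 0
    have a3 := hA 2 1
    generalize hQ : (fun i j => ∑ a, R a i j a) = Q at *
    have hQ' : ∀ i j, ∑ a, R a i j a = Q i j := fun i j => by rw [← hQ]
    simp only [hQ'] at hJ' hP ⊢
    have hq : Q 2 2 = 4 * J - Q 0 0 - Q 1 1 := by
      simp only [Fin.sum_univ_three] at hJ'
      linarith
    simp only [hP, hS, Fin.sum_univ_three, a1, a2, a3, hq, Fin.isValue, Fin.reduceEq, if_true,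
      if_false]
    ring
  -- Of the two metric terms in `DW`, one is paired with the trace of A and vanishes; the other
  -- contributes half of A_{ij}∇_i d_j.
  have hADW : ∑ i, ∑ j, A i j * ∑ k, DW k k i j
      = -(∑ i, ∑ j, A i j * ∑ k, C k k i j) + (∑ i, ∑ j, A i j * ∑ k, C k i k j)
        + (1 / 2) * ∑ i, ∑ j, A i j * ∑ k, C i k k j := by
    have a1 := hA 1 0
    have a2 := hA 2 0
    have a3 := hA 2 1
    have a4 : A 2 2 = -A 0 0 - A 1 1 := by
      simp only [Fin.sum_univ_three] at hA0
      linarith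
    simp only [hDW, Fin.sum_univ_three, a1, a2, a3, a4, Fin.isValue, Fin.reduceEq, if_true,
      if_false]
    ring
  simp only [← hd]
  rw [hPS, hADW]
  rw [hcurv, ← hJ] at hcomm
  -- With X and Y the two orders of differentiation, X + Y is wanted, while (4/3)(A, δW) supplies
  -- (4/3)X + (2/3)Y. The difference is -1/3 of the commutator.
  linear_combination (-1 / 3 : ℝ) * hcomm

end Orthonormal

/-! ### Components in a frame -/

section Frame

variable {n : ℕ}

/-- The components `u(e_a)` of a one-tensor in the frame `e`. -/
def frame1 (e : Fin n → Fin n → ℝ) (u : Fin n → ℝ) (a : Fin n) : ℝ := ∑ i, e a i * u i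

/-- The components `t(e_a, e_b)` of a two-tensor in the frame `e`. -/
def frame2 (e : Fin n → Fin n → ℝ) (t : Fin n → Fin n → ℝ) (a b : Fin n) : ℝ :=
  frame1 e (fun i => frame1 e (t i) b) a

/-- The components of a three-tensor in the frame `e`. -/
def frame3 (e : Fin n → Fin n → ℝ) (t : Fin n → Fin n → Fin n → ℝ) (a b c : Fin n) : ℝ :=
  frame1 e (fun i => frame2 e (t i) b c) a

/-- The components of a four-tensor in the frame `e`. -/
def frame4 (e : Fin n → Fin n → ℝ) (t : Fin n → Fin n → Fin n → Fin n → ℝ) (a b c d : Fin n) : ℝ :=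
  frame1 e (fun i => frame3 e (t i) b c d) a

variable {e : Fin n → Fin n → ℝ} {H : Fin n → Fin n → ℝ}

theorem frame1_add (u v : Fin n → ℝ) (a : Fin n) :
    frame1 e (fun i => u i + v i) a = frame1 e u a + frame1 e v a := by
  simp only [frame1, mul_add, Finset.sum_add_distrib]

theorem frame1_sub (u v : Fin n → ℝ) (a : Fin n) :
    frame1 e (fun i => u i - v i) a = frame1 e u a - frame1 e v a := by
  simp only [frame1, mul_sub, Finset.sum_sub_distrib]

theorem frame1_neg (u : Fin n → ℝ) (a : Fin n) :
    frame1 e (fun i => -u i) a = -frame1 e u a := by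
  simp only [frame1, mul_neg, Finset.sum_neg_distrib]

theorem frame1_mul_left (c : ℝ) (u : Fin n → ℝ) (a : Fin n) :
    frame1 e (fun i => c * u i) a = c * frame1 e u a := by
  simp only [frame1, Finset.mul_sum, mul_left_comm]

theorem frame1_mul_right (c : ℝ) (u : Fin n → ℝ) (a : Fin n) :
    frame1 e (fun i => u i * c) a = frame1 e u a * c := by
  simp only [frame1, Finset.sum_mul, mul_assoc]

theorem frame1_div (c : ℝ) (u : Fin n → ℝ) (a : Fin n) :
    frame1 e (fun i => u i / c) a = frame1 e u a / c := by
  simp only [frame1, Finset.sum_div, mul_div_assoc]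

theorem frame1_sum {ι : Type*} (s : Finset ι) (u : Fin n → ι → ℝ) (a : Fin n) :
    frame1 e (fun i => ∑ c ∈ s, u i c) a = ∑ c ∈ s, frame1 e (fun i => u i c) a := by
  simp only [frame1, Finset.mul_sum]
  exact Finset.sum_comm

theorem frame1_comm (t : Fin n → Fin n → ℝ) (a b : Fin n) :
    frame1 e (fun j => frame1 e (fun i => t i j) a) b
      = frame1 e (fun i => frame1 e (fun j => t i j) b) a := by
  simp only [frame1, Finset.mul_sum]
  rw [Finset.sum_comm]
  exact Finset.sum_congr rfl fun _ _ => Finset.sum_congr rfl fun _ _ => by ring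

/-- This converts contraction with an inverse metric H = ∑ e_a ⊗ e_a into a diagonal sum over frame
components. It is the only bridge needed between coordinate contractions and the orthonormal
algebra. -/
theorem sum_mul_eq_frame (he : ∀ i j, H i j = ∑ a, e a i * e a j) (t : Fin n → Fin n → ℝ) :
    ∑ i, ∑ j, H i j * t i j = ∑ a, frame2 e t a a := by
  simp only [he, frame2, frame1, Finset.mul_sum, Finset.sum_mul]
  rw [Finset.sum_comm]
  calc _ = ∑ j, ∑ a, ∑ i, e a i * e a j * t i j :=
        Finset.sum_congr rfl fun _ _ => Finset.sum_comm
    _ = ∑ a, ∑ j, ∑ i, e a i * e a j * t i j := Finset.sum_comm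
    _ = ∑ a, ∑ i, ∑ j, e a i * e a j * t i j :=
        Finset.sum_congr rfl fun _ _ => Finset.sum_comm
    _ = _ := by simp only [mul_assoc]

theorem sum_mul_mul_eq_frame (he : ∀ i j, H i j = ∑ a, e a i * e a j) (u v : Fin n → ℝ) :
    ∑ i, ∑ j, H i j * (u i * v j) = ∑ a, frame1 e u a * frame1 e v a := by
  rw [sum_mul_eq_frame he]
  simp only [frame2, frame1_mul_left, frame1_mul_right]

theorem sum_mul_mul_eq_frame' (he : ∀ i j, H i j = ∑ a, e a i * e a j) (u v : Fin n → ℝ) :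
    ∑ j, ∑ i, H i j * (u i * v j) = ∑ a, frame1 e u a * frame1 e v a := by
  rw [Finset.sum_comm, sum_mul_mul_eq_frame he]

theorem sum_mul_eq_frame' (he : ∀ i j, H i j = ∑ a, e a i * e a j) (t : Fin n → Fin n → ℝ) :
    ∑ j, ∑ i, H i j * t i j = ∑ a, frame2 e t a a := by
  rw [Finset.sum_comm, sum_mul_eq_frame he]

/-- A positive definite form has an orthonormal frame. -/
theorem exists_orthonormal_frame {g : Fin n → Fin n → ℝ} (hg : (Matrix.of g).PosDef) :
    ∃ e : Fin n → Fin n → ℝ,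
      (∀ i j, ((Matrix.of g)⁻¹ : Matrix (Fin n) (Fin n) ℝ) i j = ∑ a, e a i * e a j) ∧
      ∀ a b, frame2 e g a b = if a = b then 1 else 0 := by
  -- A positive matrix factors as g = BᵀB; the columns of B⁻¹ then form an orthonormal frame.
  obtain ⟨B, hB⟩ : ∃ B : Matrix (Fin n) (Fin n) ℝ, Matrix.of g = B.conjTranspose * B := by
    open scoped MatrixOrder in
    obtain ⟨B, hB⟩ := CStarAlgebra.nonneg_iff_eq_star_mul_self.1 hg.posSemidef.nonneg
    exact ⟨B, hB⟩
  have hdet : IsUnit B.det := by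
    have h := hg.det_pos.ne'
    rw [hB, Matrix.det_mul] at h
    exact isUnit_iff_ne_zero.2 (right_ne_zero_of_mul h)
  rw [Matrix.conjTranspose_eq_transpose_of_trivial] at hB
  refine ⟨fun a i => B⁻¹ i a, fun i j => ?_, fun a b => ?_⟩
  · rw [hB, Matrix.mul_inv_rev, ← Matrix.transpose_nonsing_inv, Matrix.mul_apply]
    rfl
  · have h : (B⁻¹).transpose * Matrix.of g * B⁻¹ = 1 := by
      rw [hB, Matrix.mul_assoc, Matrix.mul_assoc, Matrix.mul_nonsing_inv _ hdet, Matrix.mul_one,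
        ← Matrix.transpose_mul, Matrix.mul_nonsing_inv _ hdet, Matrix.transpose_one]
    have h2 := congrFun (congrFun h a) b
    rw [Matrix.one_apply] at h2
    rw [← h2, Matrix.mul_assoc, Matrix.mul_apply]
    simp only [frame2, frame1, Matrix.mul_apply, Matrix.transpose_apply, Matrix.of_apply]
    simp only [mul_comm]

end Frame

/-! ### Scalar products of tensors in frame components. -/

section InnerFrame

variable {n : ℕ} {e : Fin n → Fin n → ℝ} {g : TwoTensor n} {z : Coord n}

theorem inner1_eq_frame (he : ∀ i j, invMetric g z i j = ∑ a, e a i * e a j)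
    (α β : OneTensor n) :
    inner1 g α β z = ∑ a, frame1 e (α z) a * frame1 e (β z) a := by
  rw [← sum_mul_mul_eq_frame he]
  simp only [inner1, mul_assoc]

theorem inner2_eq_frame (he : ∀ i j, invMetric g z i j = ∑ a, e a i * e a j)
    (b c : TwoTensor n) :
    inner2 g b c z = ∑ p, ∑ q, frame2 e (b z) p q * frame2 e (c z) p q := by
  have h1 : inner2 g b c z = ∑ i, ∑ k, invMetric g z i k *
      ∑ j, ∑ l, invMetric g z j l * (b z i j * c z k l) := by
    unfold inner2
    refine Finset.sum_congr rfl fun i _ => ?_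
    rw [Finset.sum_comm]
    refine Finset.sum_congr rfl fun k _ => ?_
    simp only [Finset.mul_sum]
    exact Finset.sum_congr rfl fun j _ => Finset.sum_congr rfl fun l _ => by ring
  simp only [h1, sum_mul_mul_eq_frame he]
  rw [sum_mul_eq_frame he]
  simp only [frame2, frame1_sum, frame1_mul_left, frame1_mul_right]

theorem inner3_eq_frame (he : ∀ i j, invMetric g z i j = ∑ a, e a i * e a j)
    (s t : ThreeTensor n) :
    inner3 g s t z = ∑ p, ∑ q, ∑ r, frame3 e (s z) p q r * frame3 e (t z) p q r := by
  -- The first index pair is split off and frozen, which reduces the rest to the case of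
  -- two-tensors.
  have h1 : inner3 g s t z = ∑ i, ∑ a, invMetric g z i a *
      inner2 g (fun _ => s z i) (fun _ => t z a) z := by
    unfold inner3 inner2
    refine Finset.sum_congr rfl fun i _ => ?_
    refine ((Finset.sum_congr rfl fun j _ => Finset.sum_comm).trans Finset.sum_comm).trans ?_
    refine Finset.sum_congr rfl fun k _ => ?_
    simp only [Finset.mul_sum]
    exact Finset.sum_congr rfl fun _ _ => Finset.sum_congr rfl fun _ _ =>
      Finset.sum_congr rfl fun _ _ => Finset.sum_congr rfl fun _ _ => by ring
  simp only [h1, inner2_eq_frame he]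
  rw [sum_mul_eq_frame he]
  simp only [frame3, frame2, frame1_sum, frame1_mul_left, frame1_mul_right]

end InnerFrame

/-! ### The intrinsic identity on a three-dimensional Riemannian manifold -/

section Intrinsic

variable {D T : Set (Coord 3)} {g : TwoTensor 3} {z : Coord 3} {A : TwoTensor 3}

theorem IsMetricOn.smooth_square {n : ℕ} {D T : Set (Coord n)} {g A : TwoTensor n}
    (hg : IsMetricOn D T g) (hA : ∀ i j, SmoothIn D T (fun y => A y i j)) (i j : Fin n) :
    SmoothIn D T (fun y => square g A y i j) :=
  SmoothIn.sum fun _ => SmoothIn.sum fun _ => ((hg.smooth_inv _ _).mul (hA _ _)).mul (hA _ _)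

theorem IsMetricOn.smooth_trace {n : ℕ} {D T : Set (Coord n)} {g A : TwoTensor n}
    (hg : IsMetricOn D T g) (hA : ∀ i j, SmoothIn D T (fun y => A y i j)) :
    SmoothIn D T (trace g A) :=
  SmoothIn.sum fun _ => SmoothIn.sum fun _ => (hg.smooth_inv _ _).mul (hA _ _)

theorem IsMetricOn.smooth_traceFree {n : ℕ} {D T : Set (Coord n)} {g A : TwoTensor n}
    (hg : IsMetricOn D T g) (hA : ∀ i j, SmoothIn D T (fun y => A y i j)) (i j : Fin n) :
    SmoothIn D T (fun y => traceFree g A y i j) :=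
  (hA i j).sub (((hg.smooth_trace hA).div_const _).mul (hg.smooth i j))

theorem IsMetricOn.smooth_div2 {n : ℕ} {D T : Set (Coord n)} {g A : TwoTensor n}
    (hT : IsChartDomain D T) (hg : IsMetricOn D T g)
    (hA : ∀ i j, SmoothIn D T (fun y => A y i j)) (j : Fin n) :
    SmoothIn D T (fun y => div2 D g A y j) :=
  SmoothIn.sum fun _ => SmoothIn.sum fun _ => (hg.smooth_inv _ _).mul (hg.smooth_nabla2 hT hA _ _ _)

/-- `∇∇(A²)` in terms of `A`, `∇A` and `∇∇A`. -/
theorem IsMetricOn.nabla3_nabla2_square (hT : IsChartDomain D T) (hg : IsMetricOn D T g)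
    (hA : ∀ i j, SmoothIn D T (fun y => A y i j)) (hz : z ∈ T) (p m i j : Fin 3) :
    nabla3 D g (nabla2 D g (square g A)) z p m i j
      = (∑ k, ∑ l, invMetric g z l k * (nabla3 D g (nabla2 D g A) z p m i l * A z k j
          + nabla2 D g A z m i l * nabla2 D g A z p k j))
        + ∑ k, ∑ l, invMetric g z l k * (nabla2 D g A z p i l * nabla2 D g A z m k j
          + A z i l * nabla3 D g (nabla2 D g A) z p m k j) := by
  have hB := hg.smooth_nabla2 hT hA
  rw [nabla3_congr hT (fun y hy k i j => hg.nabla2_square hT hA hy k i j) hz, nabla3_add hT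
    (fun m i j => SmoothIn.sum fun k => SmoothIn.sum fun l =>
      (hg.smooth_inv l k).mul ((hB m i l).mul (hA k j)))
    (fun m i j => SmoothIn.sum fun k => SmoothIn.sum fun l =>
      (hg.smooth_inv l k).mul ((hA i l).mul (hB m k j))) hz,
    hg.nabla3_mul_right hT hA hB hz, hg.nabla3_mul_left hT hA hB hz]

/-- Since ∇g = 0 and ∇ commutes with traces, taking the trace-free part commutes with both
derivatives. -/
theorem IsMetricOn.nabla3_nabla2_traceFree (hT : IsChartDomain D T) (hg : IsMetricOn D T g)
    (hA : ∀ i j, SmoothIn D T (fun y => A y i j)) (hz : z ∈ T) (p m i j : Fin 3) :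
    nabla3 D g (nabla2 D g (traceFree g A)) z p m i j
      = nabla3 D g (nabla2 D g A) z p m i j
        - (∑ a, ∑ b, invMetric g z a b * nabla3 D g (nabla2 D g A) z p m a b) / 3 * g z i j := by
  have hB := hg.smooth_nabla2 hT hA
  have hω : ∀ k, SmoothIn D T
      (fun y => ∑ a, ∑ b, invMetric g y a b * nabla2 D g A y k a b) := fun k =>
    SmoothIn.sum fun a => SmoothIn.sum fun b => (hg.smooth_inv a b).mul (hB k a b)
  have h1 : ∀ y ∈ T, ∀ k i j, nabla2 D g (traceFree g A) y k i j = nabla2 D g A y k i j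
      - ((∑ a, ∑ b, invMetric g y a b * nabla2 D g A y k a b) * g y i j) / 3 := by
    intro y hy k i j
    have ht := (hg.smooth_trace hA).div_const 3
    have := nabla2_sub (g := g) hT hA (fun i j => ht.mul (hg.smooth i j)) hy k i j
    rw [hg.nabla2_smul_metric hT ht hy, pd_div_const hT (hg.smooth_trace hA) hy,
      hg.pd_trace hT hA hy] at this
    rw [show traceFree g A = fun y i j => A y i j - trace g A y / 3 * g y i j by
      ext; simp [traceFree], this]
    ring
  rw [nabla3_congr hT h1 hz, nabla3_sub hT hB
    (fun k i j => ((hω k).mul (hg.smooth i j)).div_const 3) hz,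
    nabla3_div_const hT (fun k i j => (hω k).mul (hg.smooth i j)) hz,
    hg.nabla3_mul_metric hT hω hz, hg.nabla1_contract_right hT hB hz]
  ring

theorem IsMetricOn.div1_div2 (hT : IsChartDomain D T) (hg : IsMetricOn D T g)
    (hA : ∀ i j, SmoothIn D T (fun y => A y i j)) (hz : z ∈ T) :
    div1 D g (div2 D g A) z = ∑ i, ∑ j, invMetric g z i j *
      ∑ a, ∑ k, invMetric g z k a * nabla3 D g (nabla2 D g A) z i k a j := by
  unfold div1
  simp only [← hg.nabla1_contract_left hT (hg.smooth_nabla2 hT hA) hz]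
  rfl

theorem nabla2_symm {n : ℕ} {D T : Set (Coord n)} {g A : TwoTensor n} {z : Coord n}
    (hT : IsChartDomain D T) (hA : ∀ y ∈ T, ∀ i j, A y i j = A y j i) (hz : z ∈ T)
    (k i j : Fin n) : nabla2 D g A z k i j = nabla2 D g A z k j i := by
  unfold nabla2
  rw [pd_congr hT (fun y hy => hA y hy i j) hz]
  simp only [hA z hz _ j, hA z hz i _]
  ring

theorem nabla3_symm {n : ℕ} {D T : Set (Coord n)} {g : TwoTensor n} {z : Coord n}
    {t : ThreeTensor n} (hT : IsChartDomain D T)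
    (ht : ∀ y ∈ T, ∀ k i j, t y k i j = t y k j i) (hz : z ∈ T)
    (l k i j : Fin n) : nabla3 D g t z l k i j = nabla3 D g t z l k j i := by
  unfold nabla3
  rw [pd_congr hT (fun y hy => ht y hy k i j) hz]
  simp only [ht z hz _ _ j, ht z hz k i _]
  ring

/-! ### Tensor symmetries pass to frame components. -/

section FrameSymmetry

variable {n : ℕ} {e : Fin n → Fin n → ℝ}

theorem frame2_symm {t : Fin n → Fin n → ℝ} (ht : ∀ i j, t i j = t j i) (a b : Fin n) :
    frame2 e t a b = frame2 e t b a := by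
  unfold frame2
  rw [← frame1_comm]
  simp only [ht]

theorem frame3_symm {t : Fin n → Fin n → Fin n → ℝ} (ht : ∀ k i j, t k i j = t k j i)
    (c a b : Fin n) : frame3 e t c a b = frame3 e t c b a := by
  unfold frame3
  simp only [fun i => frame2_symm (e := e) (ht i) a b]

theorem frame4_symm {t : Fin n → Fin n → Fin n → Fin n → ℝ}
    (ht : ∀ l k i j, t l k i j = t l k j i)
    (d c a b : Fin n) : frame4 e t d c a b = frame4 e t d c b a := by
  unfold frame4
  simp only [fun i => frame3_symm (e := e) (ht i) c a b]

theorem frame4_swap_left (t : Fin n → Fin n → Fin n → Fin n → ℝ) (a b c d : Fin n) :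
    frame4 e t b a c d = frame4 e (fun i j => t j i) a b c d := by
  unfold frame4 frame3
  rw [← frame1_comm]

theorem frame4_sub (s t : Fin n → Fin n → Fin n → Fin n → ℝ) (a b c d : Fin n) :
    frame4 e (fun i j k l => s i j k l - t i j k l) a b c d
      = frame4 e s a b c d - frame4 e t a b c d := by
  simp only [frame4, frame3, frame2, frame1_sub]

theorem frame4_neg (t : Fin n → Fin n → Fin n → Fin n → ℝ) (a b c d : Fin n) :
    frame4 e (fun i j k l => -t i j k l) a b c d = -frame4 e t a b c d := by
  simp only [frame4, frame3, frame2, frame1_neg]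

theorem frame4_antisymm_left {t : Fin n → Fin n → Fin n → Fin n → ℝ}
    (ht : ∀ i j k l, t i j k l = -t j i k l) (a b c d : Fin n) :
    frame4 e t a b c d = -frame4 e t b a c d := by
  rw [frame4_swap_left t a b, ← frame4_neg]
  congr 1
  ext i j k l
  exact ht i j k l

theorem frame4_antisymm_right {t : Fin n → Fin n → Fin n → Fin n → ℝ}
    (ht : ∀ i j k l, t i j k l = -t i j l k) (a b c d : Fin n) :
    frame4 e t a b c d = -frame4 e t a b d c := by
  have h : frame4 e t a b d c = frame4 e (fun i j k l => t i j l k) a b c d := by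
    unfold frame4 frame3 frame2
    simp only [fun i j => frame1_comm (e := e) (t i j) d c]
  rw [h, ← frame4_neg]
  congr 1
  ext i j k l
  exact ht i j k l

/-- The innermost frame sum is moved to the front past two others. This is how a contraction over
leading slots, performed last, is brought into the slot order of `frame3` and `frame4`. -/
theorem frame1_move (t : Fin n → Fin n → Fin n → ℝ) (a b c : Fin n) :
    frame1 e (fun j => frame1 e (fun k => frame1 e (fun i => t i j k) a) c) b
      = frame1 e (fun i => frame1 e (fun j => frame1 e (t i j) c) b) a := by
  simp only [fun j => frame1_comm (e := e) (fun i k => t i j k) a c]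
  exact frame1_comm (e := e) (fun i j => frame1 e (t i j) c) a b

theorem frame4_pair_symm {t : Fin n → Fin n → Fin n → Fin n → ℝ}
    (ht : ∀ i j k l, t i j k l = t k l i j) (a b c d : Fin n) :
    frame4 e t a b c d = frame4 e t c d a b := by
  have h : frame4 e t c d a b = frame4 e (fun i j k l => t k l i j) a b c d := by
    unfold frame4 frame3 frame2
    rw [frame1_move (fun i2 j k => frame1 e (t j k i2) b)]
    simp only [fun i2 => frame1_move (e := e) (fun i3 j k => t j k i2 i3) b c d]
  rw [h]
  congr 1
  ext i j k l
  exact ht i j k l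

end FrameSymmetry

/-- The identity for a trace-free symmetric two-tensor `A` on a three-dimensional Riemannian
manifold whose antisymmetrized derivative has trace-free part `-W`. -/
theorem IsMetricOn.divergence_square_identity (hT : IsChartDomain D T) (hg : IsMetricOn D T g)
    (hA : ∀ i j, SmoothIn D T (fun y => A y i j)) (hAs : ∀ y ∈ T, ∀ i j, A y i j = A y j i)
    (hA0 : ∀ y ∈ T, trace g A y = 0) {W : ThreeTensor 3}
    (hW : ∀ y ∈ T, ∀ k i j, W y k i j = -(nabla2 D g A y k i j - nabla2 D g A y i k j)
      + (div2 D g A y i * g y k j - div2 D g A y k * g y i j) / 2)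
    (hz : z ∈ T) (hpos : (Matrix.of (g z)).PosDef) :
    div1 D g (div2 D g (traceFree g (square g A))) z
        + inner2 g (schouten D g) (traceFree g (square g A)) z
      = (2 / 3) * inner2 g A (laplacian2 D g A) z
        + (1 / 3) * inner3 g (nabla2 D g A) (nabla2 D g A) z
        + (1 / 2) * inner1 g (div2 D g A) (div2 D g A) z
        - (2 / 3) * schoutenJ D g z * inner2 g A A z
        + (4 / 3) * inner2 g A (div3 D g W) z
        - (1 / 2) * inner3 g W W z := by
  obtain ⟨e, he, heg⟩ := exists_orthonormal_frame hpos
  change ∀ i j, invMetric g z i j = _ at he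
  have hS := hg.smooth_square hA
  have hB := hg.smooth_nabla2 hT hA
  have hBs := fun k i j => nabla2_symm (g := g) hT hAs hz k i j
  have hCs := nabla3_symm (g := g) hT (fun y hy => nabla2_symm (g := g) hT hAs hy) hz
  -- The trace of A vanishes on all of `T`, so its derivative vanishes as well.
  have hB0 : ∀ k, ∑ i, ∑ j, invMetric g z i j * nabla2 D g A z k i j = 0 := fun k => by
    rw [← hg.pd_trace hT hA hz, pd_congr hT hA0 hz, pd_const]
  have hd := hg.smooth_div2 hT hA
  -- The relation `hW` holds throughout `T`, so it may be differentiated. Because ∇g = 0, only the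
  -- divergence is differentiated in the metric terms.
  have hDW : ∀ l k i j, nabla3 D g W z l k i j
      = -(nabla3 D g (nabla2 D g A) z l k i j - nabla3 D g (nabla2 D g A) z l i k j)
        + ((∑ a, ∑ b, invMetric g z b a * nabla3 D g (nabla2 D g A) z l b a i) * g z k j
          - (∑ a, ∑ b, invMetric g z b a * nabla3 D g (nabla2 D g A) z l b a k) * g z i j) / 2 := by
    intro l k i j
    have hW' : ∀ y ∈ T, ∀ k i j, W y k i j
        = (nabla2 D g A y i k j - nabla2 D g A y k i j)
        + (div2 D g A y i * g y k j - div2 D g A y k * g y i j) / 2 := fun y hy k i j => by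
      rw [hW y hy]
      ring
    have s1 : ∀ k i j, SmoothIn D T (fun y => nabla2 D g A y i k j) := fun k i j => hB i k j
    have s2 : ∀ k i j, SmoothIn D T (fun y => div2 D g A y k * g y i j) :=
      fun k i j => (hd k).mul (hg.smooth i j)
    have s3 : ∀ k i j, SmoothIn D T (fun y => div2 D g A y i * g y k j) := fun k i j => s2 i k j
    rw [nabla3_congr hT hW' hz, nabla3_add hT (fun k i j => (s1 k i j).sub (hB k i j))
      (fun k i j => ((s3 k i j).sub (s2 k i j)).div_const 2) hz, nabla3_sub hT s1 hB hz,
      nabla3_div_const hT (fun k i j => (s3 k i j).sub (s2 k i j)) hz, nabla3_sub hT s3 s2 hz,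
      nabla3_swap D g (nabla2 D g A), nabla3_swap D g (fun y k i j => div2 D g A y k * g y i j),
      hg.nabla3_mul_metric hT hd hz, hg.nabla3_mul_metric hT hd hz,
      ← hg.nabla1_contract_left hT hB hz, ← hg.nabla1_contract_left hT hB hz]
    unfold div2
    ring
  -- In an orthonormal frame the raised index of the curvature in the Ricci identity becomes an
  -- ordinary one.
  have hRU : ∀ i j k (u : Fin 3 → ℝ), ∑ a, riemannUp D g z i j k a * u a
      = ∑ c, frame1 e (riemann D g z i j k) c * frame1 e u c := by
    intro i j k u
    rw [← sum_mul_mul_eq_frame he]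
    refine (Finset.sum_congr rfl fun a _ => ?_).trans Finset.sum_comm
    rw [hg.riemannUp_eq hz, Finset.sum_mul]
    exact Finset.sum_congr rfl fun b _ => by rw [hg.inv_symm hz a b]; ring
  have hRic := hg.ricci_identity hT hA hz
  simp only [hRU] at hRic
  have hfA : ∀ a b, frame2 e (A z) a b = frame2 e (A z) b a := frame2_symm (hAs z hz)
  have hfB : ∀ c a b, frame3 e (nabla2 D g A z) c a b = frame3 e (nabla2 D g A z) c b a :=
    frame3_symm hBs
  have hRic' : ∀ l k i j, frame4 e (nabla3 D g (nabla2 D g A) z) l k i j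
      - frame4 e (nabla3 D g (nabla2 D g A) z) k l i j
      = -(∑ a, frame4 e (riemann D g z) l k i a * frame2 e (A z) a j)
        - ∑ a, frame4 e (riemann D g z) l k j a * frame2 e (A z) i a := by
    intro l k i j
    rw [frame4_swap_left, ← frame4_sub]
    simp only [hRic, frame4, frame3, frame2, frame1_sub, frame1_neg, frame1_sum, frame1_mul_left,
      frame1_mul_right]
    have hR : ∀ x i, _ := fun x i => frame1_comm (e := e)
      (fun i₂ i₁ => frame1 e (fun k => frame1 e (riemann D g z i₂ i₁ k) x) i) l k
    simp only [frame1_comm (e := e) (A z)]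
    simp only [hR]
  have hN : ∀ p m i j, frame4 e (nabla3 D g (nabla2 D g (square g A)) z) p m i j
      = ∑ c, (frame4 e (nabla3 D g (nabla2 D g A) z) p m i c * frame2 e (A z) c j
        + frame3 e (nabla2 D g A z) m i c * frame3 e (nabla2 D g A z) p c j
        + (frame3 e (nabla2 D g A z) p i c * frame3 e (nabla2 D g A z) m c j
        + frame2 e (A z) i c * frame4 e (nabla3 D g (nabla2 D g A) z) p m c j)) := by
    intro p m i j
    rw [show nabla3 D g (nabla2 D g (square g A)) z = fun p m i j => _ from
      funext₂ fun p m => funext₂ fun i j => hg.nabla3_nabla2_square hT hA hz p m i j]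
    simp only [frame4, frame3, frame2, mul_add, Finset.sum_add_distrib, sum_mul_mul_eq_frame' he,
      frame1_add, frame1_sum, frame1_mul_left, frame1_mul_right]
    simp only [frame1_comm (e := e) (A z), fun i => frame1_comm (e := e) (nabla2 D g A z i),
      fun i k => frame1_comm (e := e) (nabla3 D g (nabla2 D g A) z i k)]
  have hfd : ∀ j, frame1 e (div2 D g A z) j = ∑ a, frame3 e (nabla2 D g A z) a a j := by
    intro j
    rw [show div2 D g A z = fun j => _ from funext fun j => sum_mul_eq_frame' he _]
    simp only [frame3, frame2, frame1_sum]
    simp only [fun c => frame1_comm (e := e) (fun i k => frame1 e (fun l => nabla2 D g A z i l k) c) c,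
      fun i => frame1_comm (e := e) (nabla2 D g A z i)]
  have hfW : ∀ k i j, frame3 e (W z) k i j
      = -(frame3 e (nabla2 D g A z) k i j - frame3 e (nabla2 D g A z) i k j)
        + (frame1 e (div2 D g A z) i * (if k = j then 1 else 0)
          - frame1 e (div2 D g A z) k * (if i = j then 1 else 0)) / 2 := by
    intro k i j
    rw [← heg, ← heg]
    rw [show W z = fun k i j => _ from funext fun k => funext₂ fun i j => hW z hz k i j]
    simp only [frame3, frame2, frame1_add, frame1_neg, frame1_sub, frame1_div,
      frame1_mul_left, frame1_mul_right]
    rw [frame1_comm (e := e) (fun i k => frame1 e (nabla2 D g A z i k) j)]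
  have hfDW : ∀ l k i j, frame4 e (nabla3 D g W z) l k i j
      = -(frame4 e (nabla3 D g (nabla2 D g A) z) l k i j
          - frame4 e (nabla3 D g (nabla2 D g A) z) l i k j)
        + ((∑ a, frame4 e (nabla3 D g (nabla2 D g A) z) l a a i) * (if k = j then 1 else 0)
          - (∑ a, frame4 e (nabla3 D g (nabla2 D g A) z) l a a k)
            * (if i = j then 1 else 0)) / 2 := by
    intro l k i j
    rw [← heg, ← heg]
    rw [show nabla3 D g W z = fun l k i j => _ from
      funext₂ fun l k => funext₂ fun i j => hDW l k i j]
    simp only [frame4, frame3, frame2, frame1_add, frame1_neg, frame1_sub, frame1_div,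
      frame1_mul_left, frame1_mul_right, frame1_sum, sum_mul_eq_frame' he]
    simp only [fun l => frame1_comm (e := e) (fun i k => frame1 e (nabla3 D g (nabla2 D g A) z l i k) j),
      fun l c => frame1_comm (e := e) (fun k i => frame1 e (fun j => nabla3 D g (nabla2 D g A) z l k j i) c) c,
      fun l k => frame1_comm (e := e) (nabla3 D g (nabla2 D g A) z l k)]
  have hric : ∀ i j, frame2 e (ricci D g z) i j = ∑ a, frame4 e (riemann D g z) a i j a := by
    intro i j
    rw [show ricci D g z = fun j k => _ from funext₂ fun j k => hg.ricci_eq hz j k]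
    simp only [frame4, frame3, frame2, sum_mul_eq_frame he, frame1_sum]
    simp only [fun c => frame1_move (e := e) (fun l i k => frame1 e (riemann D g z l i k) c)]
  have hJ : schoutenJ D g z = (∑ i, ∑ a, frame4 e (riemann D g z) a i i a) / 4 := by
    unfold schoutenJ trace
    rw [sum_mul_eq_frame he]
    simp only [hric]
    norm_num
  have hP : ∀ i j, frame2 e (schouten D g z) i j
      = (∑ a, frame4 e (riemann D g z) a i j a) - schoutenJ D g z * (if i = j then 1 else 0) := by
    intro i j
    rw [← heg, ← hric]
    rw [show schouten D g z = fun i j => ricci D g z i j - schoutenJ D g z * g z i j by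
      funext i j; simp only [schouten]; norm_num]
    simp only [frame2, frame1_sub, frame1_mul_left]
  have hsq : ∀ i j, frame2 e (square g A z) i j
      = ∑ c, frame2 e (A z) i c * frame2 e (A z) c j := by
    intro i j
    rw [show square g A z = fun i j => ∑ k, ∑ l, invMetric g z l k * (A z i l * A z k j) by
      funext i j; simp only [square, mul_assoc]]
    simp only [frame2, sum_mul_mul_eq_frame' he, frame1_sum, frame1_mul_left,
      frame1_mul_right]
    simp only [frame1_comm (e := e) (A z)]
  have hfS : ∀ i j, frame2 e (traceFree g (square g A) z) i j
      = (∑ c, frame2 e (A z) i c * frame2 e (A z) c j)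
        - (∑ a, ∑ c, frame2 e (A z) a c * frame2 e (A z) c a) / 3 * (if i = j then 1 else 0) := by
    intro i j
    rw [← heg, ← hsq]
    simp only [← hsq]
    rw [← sum_mul_eq_frame he]
    rw [show traceFree g (square g A) z = fun i j => square g A z i j
      - (∑ a, ∑ b, invMetric g z a b * square g A z a b) / 3 * g z i j by
      funext i j; simp [traceFree, trace]]
    simp only [frame2, frame1_sub, frame1_mul_left]
  have hLap : ∀ i j, frame2 e (laplacian2 D g A z) i j
      = ∑ k, frame4 e (nabla3 D g (nabla2 D g A) z) k k i j := by
    intro i j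
    rw [show laplacian2 D g A z = fun i j => _ from funext₂ fun i j => sum_mul_eq_frame he _]
    simp only [frame4, frame3, frame2, frame1_sum]
    simp only [fun c => frame1_move (e := e) (fun k i j => frame1 e (fun l => nabla3 D g (nabla2 D g A) z k l i j) c),
      fun k => frame1_move (e := e) (fun l i j => nabla3 D g (nabla2 D g A) z k l i j)]
  have hDiv3 : ∀ i j, frame2 e (div3 D g W z) i j = ∑ k, frame4 e (nabla3 D g W z) k k i j := by
    intro i j
    rw [show div3 D g W z = fun i j => _ from funext₂ fun i j => sum_mul_eq_frame' he _]
    simp only [frame4, frame3, frame2, frame1_sum]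
    simp only [fun c => frame1_move (e := e) (fun k i j => frame1 e (fun l => nabla3 D g W z k l i j) c),
      fun k => frame1_move (e := e) (fun l i j => nabla3 D g W z k l i j)]
  have hTF : ∀ p m i j, frame4 e (nabla3 D g (nabla2 D g (traceFree g (square g A))) z) p m i j
      = frame4 e (nabla3 D g (nabla2 D g (square g A)) z) p m i j
        - (∑ b, frame4 e (nabla3 D g (nabla2 D g (square g A)) z) p m b b) / 3
          * (if i = j then 1 else 0) := by
    intro p m i j
    rw [← heg, show nabla3 D g (nabla2 D g (traceFree g (square g A))) z = fun p m i j => _ from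
      funext₂ fun p m => funext₂ fun i j => hg.nabla3_nabla2_traceFree hT hS hz p m i j]
    simp only [frame4, frame3, frame2, frame1_sub, frame1_div, frame1_mul_left, frame1_mul_right,
      frame1_sum, sum_mul_eq_frame he]
  have hDD : div1 D g (div2 D g (traceFree g (square g A))) z = ∑ i, ∑ a,
      frame4 e (nabla3 D g (nabla2 D g (traceFree g (square g A))) z) i a a i := by
    rw [hg.div1_div2 hT (hg.smooth_traceFree hS) hz]
    generalize nabla3 D g (nabla2 D g (traceFree g (square g A))) z = F
    rw [sum_mul_eq_frame he]
    simp only [frame4, frame3, frame2, frame1_sum, sum_mul_eq_frame' he]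
    simp only [fun i c => frame1_comm (e := e) (fun k j => frame1 e (fun l => F i k l j) c) c,
      fun i k => frame1_comm (e := e) (F i k)]
  have main := orthonormal_identity hfA (by rw [← sum_mul_eq_frame he]; exact hA0 z hz)
    hfB (fun k => ?_) (frame4_symm hCs) (frame4_antisymm_left (riemann_antisymm D g z))
    (frame4_antisymm_right (hg.riemann_antisymm_right hT hz))
    (frame4_pair_symm (hg.riemann_pair_symm hT hz)) hRic' hN hfd hfW hfDW hJ hP hfS
  · rw [hDD, inner2_eq_frame he, inner2_eq_frame he,
      inner2_eq_frame he, inner2_eq_frame he, inner3_eq_frame he, inner3_eq_frame he,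
      inner1_eq_frame he]
    simp only [hTF, hLap, hDiv3]
    exact main
  · simp only [frame3]
    rw [← frame1_sum]
    simp only [← sum_mul_eq_frame he, hB0, frame1, mul_zero, Finset.sum_const_zero]

end Intrinsic

/-! ### Hypersurfaces in coordinates: the Gauss and Codazzi equations -/

/-- Coordinate data of a hypersurface: `f` maps `O` into the chart domain `T`, and `ν` is a unit
normal field along `f`. -/
structure IsHypersurface {n m : ℕ} (D T : Set (Coord m)) (O : Set (Coord n)) (G : TwoTensor m)
    (f : Coord n → Coord m) (ν : Coord n → Fin m → ℝ) : Prop where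
  isOpen : IsOpen O
  chart : IsChartDomain D T
  metric : IsMetricOn D T G
  posDef : ∀ z ∈ T, (Matrix.of (G z)).PosDef
  smooth_map : ∀ a, SmoothIn Set.univ O (fun y => f y a)
  mapsTo : ∀ y ∈ O, f y ∈ T
  injective : ∀ y ∈ O, ∀ v : Fin n → ℝ, (∀ a, ∑ i, tangent f y a i * v i = 0) → v = 0
  smooth_normal : ∀ a, SmoothIn Set.univ O (fun y => ν y a)
  unit : ∀ y ∈ O, ∑ a, ∑ b, G (f y) a b * ν y a * ν y b = 1
  normal : ∀ y ∈ O, ∀ i, ∑ a, ∑ b, G (f y) a b * tangent f y a i * ν y b = 0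

/-- The ambient scalar product of two vectors at the point `f x`. -/
noncomputable def pairAlong {n m : ℕ} (G : TwoTensor m) (f : Coord n → Coord m) (x : Coord n)
    (V W : Fin m → ℝ) : ℝ :=
  ∑ a, ∑ b, G (f x) a b * V a * W b

/-- The connection matrix of the pulled back connection in the direction `∂_k`. -/
noncomputable def connAlong {n m : ℕ} (D : Set (Coord m)) (G : TwoTensor m) (f : Coord n → Coord m)
    (x : Coord n) (k : Fin n) (a d : Fin m) : ℝ :=
  ∑ c, christoffel D G (f x) a c d * tangent f x c k

/-- The covariant derivative along `f` of a vector field `V` along `f`. -/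
noncomputable def covAlong {n m : ℕ} (D : Set (Coord m)) (G : TwoTensor m) (f : Coord n → Coord m)
    (V : Coord n → Fin m → ℝ) (x : Coord n) (k : Fin n) (a : Fin m) : ℝ :=
  pd Set.univ k (fun y => V y a) x + ∑ d, connAlong D G f x k a d * V x d

section General

variable {n m : ℕ} {D T : Set (Coord m)} {O : Set (Coord n)} {G : TwoTensor m}
  {f : Coord n → Coord m} {ν : Coord n → Fin m → ℝ} {x : Coord n}

theorem ambientDeriv_eq_covAlong (D : Set (Coord m)) (G : TwoTensor m) (f : Coord n → Coord m)
    (x : Coord n) (i j : Fin n) (a : Fin m) :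
    ambientDeriv D G f x i j a = covAlong D G f (fun y b => tangent f y b j) x i a := by
  unfold ambientDeriv covAlong connAlong
  rw [Finset.sum_comm]
  simp only [Finset.sum_mul]

theorem pairAlong_sub_left (V V' W : Fin m → ℝ) :
    pairAlong G f x (fun a => V a - V' a) W = pairAlong G f x V W - pairAlong G f x V' W := by
  simp only [pairAlong, mul_sub, sub_mul, Finset.sum_sub_distrib]

namespace IsHypersurface

theorem dom (hf : IsHypersurface D T O G f ν) : IsChartDomain Set.univ O := .of_isOpen hf.isOpen

theorem smooth_tangent (hf : IsHypersurface D T O G f ν) (a : Fin m) (i : Fin n) : SmoothIn Set.univ O (fun y => tangent f y a i) :=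
  (hf.smooth_map a).pd hf.dom i

theorem smooth_comp (hf : IsHypersurface D T O G f ν) {w : Coord m → ℝ} (hw : SmoothIn D T w) :
    SmoothIn Set.univ O (fun y => w (f y)) :=
  SmoothIn.comp hf.dom hf.smooth_map hf.mapsTo hf.chart.subset hw

theorem smooth_conn (hf : IsHypersurface D T O G f ν) (k : Fin n) (a d : Fin m) :
    SmoothIn Set.univ O (fun y => connAlong D G f y k a d) :=
  SmoothIn.sum fun _ => (hf.smooth_comp (hf.metric.smooth_christoffel hf.chart _ _ _)).mul
    (hf.smooth_tangent _ _)

theorem smooth_cov (hf : IsHypersurface D T O G f ν) {V : Coord n → Fin m → ℝ} (hV : ∀ a, SmoothIn Set.univ O (fun y => V y a))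
    (k : Fin n) (a : Fin m) : SmoothIn Set.univ O (fun y => covAlong D G f V y k a) :=
  ((hV a).pd hf.dom k).add (SmoothIn.sum fun _ => (hf.smooth_conn _ _ _).mul (hV _))

theorem smooth_pair (hf : IsHypersurface D T O G f ν) {V W : Coord n → Fin m → ℝ} (hV : ∀ a, SmoothIn Set.univ O (fun y => V y a))
    (hW : ∀ a, SmoothIn Set.univ O (fun y => W y a)) :
    SmoothIn Set.univ O (fun y => pairAlong G f y (V y) (W y)) :=
  SmoothIn.sum fun _ => SmoothIn.sum fun _ =>
    ((hf.smooth_comp (hf.metric.smooth _ _)).mul (hV _)).mul (hW _)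

theorem pair_symm (hf : IsHypersurface D T O G f ν) (hx : x ∈ O) (V W : Fin m → ℝ) :
    pairAlong G f x V W = pairAlong G f x W V := by
  unfold pairAlong
  rw [Finset.sum_comm]
  refine Finset.sum_congr rfl fun a _ => Finset.sum_congr rfl fun b _ => ?_
  rw [hf.metric.symm _ (hf.mapsTo x hx) b a]
  ring

/-- The chain rule turns compatibility of the ambient Christoffel symbols with G into compatibility
of the pulled back connection matrix with G ∘ f. -/
theorem pd_metric (hf : IsHypersurface D T O G f ν) (hx : x ∈ O) (k : Fin n) (a b : Fin m) :
    pd Set.univ k (fun y => G (f y) a b) x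
      = ∑ c, connAlong D G f x k c a * G (f x) c b + ∑ c, connAlong D G f x k c b * G (f x) a c := by
  rw [pd_comp hf.dom hf.smooth_map hf.mapsTo hf.chart.subset (hf.metric.smooth a b) hx]
  simp only [hf.metric.pd_metric hf.chart (hf.mapsTo x hx), add_mul, Finset.sum_add_distrib,
    Finset.sum_mul, connAlong]
  congr 1 <;>
  · rw [Finset.sum_comm]
    refine Finset.sum_congr rfl fun c _ => Finset.sum_congr rfl fun d _ => ?_
    simp only [tangent]
    ring

/-- The pulled back connection is metric. -/
theorem pd_pair (hf : IsHypersurface D T O G f ν) {V W : Coord n → Fin m → ℝ} (hV : ∀ a, SmoothIn Set.univ O (fun y => V y a))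
    (hW : ∀ a, SmoothIn Set.univ O (fun y => W y a)) (hx : x ∈ O) (k : Fin n) :
    pd Set.univ k (fun y => pairAlong G f y (V y) (W y)) x
      = pairAlong G f x (covAlong D G f V x k) (W x)
        + pairAlong G f x (V x) (covAlong D G f W x k) := by
  have hGf : ∀ a b, SmoothIn Set.univ O (fun y => G (f y) a b) :=
    fun a b => hf.smooth_comp (hf.metric.smooth a b)
  have h1 : pd Set.univ k (fun y => pairAlong G f y (V y) (W y)) x
      = ∑ a, ∑ b, ((∑ c, connAlong D G f x k c a * G (f x) c b
          + ∑ c, connAlong D G f x k c b * G (f x) a c) * V x a * W x b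
        + G (f x) a b * pd Set.univ k (fun y => V y a) x * W x b
        + G (f x) a b * V x a * pd Set.univ k (fun y => W y b) x) := by
    unfold pairAlong
    rw [pd_sum hf.dom (fun a => SmoothIn.sum fun b => ((hGf a b).mul (hV a)).mul (hW b)) hx]
    refine Finset.sum_congr rfl fun a _ => ?_
    rw [pd_sum hf.dom (fun b => ((hGf a b).mul (hV a)).mul (hW b)) hx]
    refine Finset.sum_congr rfl fun b _ => ?_
    rw [pd_mul hf.dom ((hGf a b).mul (hV a)) (hW b) hx, pd_mul hf.dom (hGf a b) (hV a) hx,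
      hf.pd_metric hx]
    ring
  have h2 : ∑ a, ∑ b, (∑ c, connAlong D G f x k c a * G (f x) c b) * V x a * W x b
      = ∑ a, ∑ b, G (f x) a b * (∑ d, connAlong D G f x k a d * V x d) * W x b := by
    simp only [Finset.mul_sum, Finset.sum_mul]
    calc _ = ∑ a, ∑ c, ∑ b, connAlong D G f x k c a * G (f x) c b * V x a * W x b :=
          Finset.sum_congr rfl fun _ _ => Finset.sum_comm
      _ = ∑ c, ∑ a, ∑ b, connAlong D G f x k c a * G (f x) c b * V x a * W x b :=
          Finset.sum_comm
      _ = ∑ c, ∑ b, ∑ a, connAlong D G f x k c a * G (f x) c b * V x a * W x b :=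
          Finset.sum_congr rfl fun _ _ => Finset.sum_comm
      _ = _ := Finset.sum_congr rfl fun _ _ => Finset.sum_congr rfl fun _ _ =>
          Finset.sum_congr rfl fun _ _ => by ring
  have h3 : ∑ a, ∑ b, (∑ c, connAlong D G f x k c b * G (f x) a c) * V x a * W x b
      = ∑ a, ∑ b, G (f x) a b * V x a * (∑ d, connAlong D G f x k b d * W x d) := by
    simp only [Finset.mul_sum, Finset.sum_mul]
    refine Finset.sum_congr rfl fun a _ => ?_
    rw [Finset.sum_comm]
    exact Finset.sum_congr rfl fun _ _ => Finset.sum_congr rfl fun _ _ => by ring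
  rw [h1]
  unfold pairAlong covAlong
  simp only [mul_add, add_mul, Finset.sum_add_distrib]
  rw [h2, h3]
  ring

/-- The pulled back connection is torsion free. -/
theorem cov_tangent_symm (hf : IsHypersurface D T O G f ν) (hx : x ∈ O) (i j : Fin n) (a : Fin m) :
    covAlong D G f (fun y b => tangent f y b j) x i a
      = covAlong D G f (fun y b => tangent f y b i) x j a := by
  unfold covAlong connAlong
  congr 1
  · exact pd_pd_comm hf.dom (hf.smooth_map a) hx i j
  · simp only [Finset.sum_mul]
    rw [Finset.sum_comm]
    refine Finset.sum_congr rfl fun c _ => Finset.sum_congr rfl fun d _ => ?_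
    rw [hf.metric.christoffel_symm hf.chart (hf.mapsTo x hx)]
    ring

theorem pd_conn (hf : IsHypersurface D T O G f ν) (hx : x ∈ O) (i k : Fin n) (a d : Fin m) :
    pd Set.univ i (fun y => connAlong D G f y k a d) x
      = ∑ c, ((∑ e, pd D e (fun z => christoffel D G z a c d) (f x) * tangent f x e i)
          * tangent f x c k
        + christoffel D G (f x) a c d * pd Set.univ i (fun y => tangent f y c k) x) := by
  have hc := fun c => hf.metric.smooth_christoffel hf.chart a c d
  unfold connAlong
  rw [pd_sum_mul hf.dom (fun c => hf.smooth_comp (hc c)) (fun c => hf.smooth_tangent c k) hx]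
  refine Finset.sum_congr rfl fun c _ => ?_
  rw [pd_comp hf.dom hf.smooth_map hf.mapsTo hf.chart.subset (hc c) hx]
  rfl

end IsHypersurface

end General

/-! ### Induced metric, second fundamental form and Weingarten equation. -/

namespace IsHypersurface

section Induced

variable {n m : ℕ} {D T : Set (Coord m)} {O : Set (Coord n)} {G : TwoTensor m}
  {f : Coord n → Coord m} {ν : Coord n → Fin m → ℝ} {x : Coord n}

theorem posDef_induced (hf : IsHypersurface D T O G f ν) (hx : x ∈ O) :
    (Matrix.of (inducedMetric G f x)).PosDef := by
  let E : Matrix (Fin m) (Fin n) ℝ := Matrix.of fun a i => tangent f x a i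
  -- The induced metric is EᵀGE with E the Jacobian matrix of f, so definiteness follows from
  -- injectivity of the differential.
  have hE : Function.Injective E.mulVec := by
    rw [← Matrix.coe_mulVecLin, ← LinearMap.ker_eq_bot, LinearMap.ker_eq_bot']
    intro v hv
    exact hf.injective x hx v fun a => congrFun hv a
  have h := (hf.posDef _ (hf.mapsTo x hx)).conjTranspose_mul_mul_same hE
  convert h using 1
  ext i j
  simp only [Matrix.mul_apply, Matrix.conjTranspose_apply, star_trivial, E, Matrix.of_apply,
    inducedMetric, Finset.sum_mul]
  rw [Finset.sum_comm]
  exact Finset.sum_congr rfl fun _ _ => Finset.sum_congr rfl fun _ _ => by ring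

theorem isMetricOn_induced (hf : IsHypersurface D T O G f ν) :
    IsMetricOn Set.univ O (inducedMetric G f) where
  smooth i j := hf.smooth_pair (fun a => hf.smooth_tangent a i) (fun a => hf.smooth_tangent a j)
  symm _ hy _ _ := hf.pair_symm hy _ _
  det_ne_zero _ hy := (hf.posDef_induced hy).det_pos.ne'

/-- The tangential part of the ambient derivative is the Levi-Civita connection of the induced
metric. -/
theorem pair_cov_tangent (hf : IsHypersurface D T O G f ν) (hx : x ∈ O) (i j k : Fin n) :
    pairAlong G f x (covAlong D G f (fun y b => tangent f y b j) x i) (fun a => tangent f x a k)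
      = ∑ l, inducedMetric G f x k l
          * christoffel Set.univ (inducedMetric G f) x l i j := by
  have hE := fun (j : Fin n) (a : Fin m) => hf.smooth_tangent a j
  have hp : ∀ i j k, pd Set.univ i (fun y => inducedMetric G f y j k) x
      = pairAlong G f x (covAlong D G f (fun y b => tangent f y b j) x i) (fun a => tangent f x a k)
        + pairAlong G f x (covAlong D G f (fun y b => tangent f y b k) x i)
          (fun a => tangent f x a j) := by
    intro i j k
    rw [hf.pair_symm hx _ (fun a => tangent f x a j)]
    exact hf.pd_pair (hE j) (hE k) hx i
  have hs : ∀ i j, covAlong D G f (fun y b => tangent f y b j) x i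
      = covAlong D G f (fun y b => tangent f y b i) x j := fun i j =>
    funext fun a => hf.cov_tangent_symm hx i j a
  -- This is the Koszul formula: each derivative of the metric splits into two pairings, and
  -- symmetry of the ambient derivative in its two indices cancels all but twice the wanted one.
  rw [hf.isMetricOn_induced.sum_mul_christoffel hx, hp, hp, hp, hs j i, hs k i, hs k j]
  ring

theorem secondFundamentalForm_eq (D : Set (Coord m)) (G : TwoTensor m) (f : Coord n → Coord m)
    (ν : Coord n → Fin m → ℝ) (x : Coord n) (i j : Fin n) :
    secondFundamentalForm D G f ν x i j
      = -pairAlong G f x (covAlong D G f (fun y b => tangent f y b j) x i) (ν x) := by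
  unfold secondFundamentalForm pairAlong
  simp only [ambientDeriv_eq_covAlong]

theorem smooth_secondFundamentalForm (hf : IsHypersurface D T O G f ν) (i j : Fin n) :
    SmoothIn Set.univ O (fun y => secondFundamentalForm D G f ν y i j) := by
  simp only [secondFundamentalForm_eq]
  exact (hf.smooth_pair (hf.smooth_cov (fun a => hf.smooth_tangent a j) i) hf.smooth_normal).neg

theorem secondFundamentalForm_symm (hf : IsHypersurface D T O G f ν) (hx : x ∈ O) (i j : Fin n) :
    secondFundamentalForm D G f ν x i j = secondFundamentalForm D G f ν x j i := by
  simp only [secondFundamentalForm_eq]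
  rw [show covAlong D G f (fun y b => tangent f y b j) x i = _ from
    funext fun a => hf.cov_tangent_symm hx i j a]

/-- Differentiate the condition that the normal has constant length one. -/
theorem pair_cov_normal (hf : IsHypersurface D T O G f ν) (hx : x ∈ O) (i : Fin n) :
    pairAlong G f x (covAlong D G f ν x i) (ν x) = 0 := by
  have h := hf.pd_pair hf.smooth_normal hf.smooth_normal hx i
  rw [pd_congr hf.dom (u := fun y => pairAlong G f y (ν y) (ν y)) (v := fun _ => 1)
     (fun y hy => hf.unit y hy) hx, pd_const,
    hf.pair_symm hx (ν x)] at h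
  linarith

/-- The Weingarten equation. -/
theorem pair_tangent_cov_normal (hf : IsHypersurface D T O G f ν) (hx : x ∈ O) (i j : Fin n) :
    pairAlong G f x (fun a => tangent f x a j) (covAlong D G f ν x i)
      = secondFundamentalForm D G f ν x i j := by
  have h := hf.pd_pair (fun a => hf.smooth_tangent a j) hf.smooth_normal hx i
  rw [pd_congr hf.dom
    (u := fun y => pairAlong G f y (fun a => tangent f y a j) (ν y)) (v := fun _ => 0)
     (fun y hy => hf.normal y hy j) hx, pd_const] at h
  rw [secondFundamentalForm_eq]
  linarith

/-- The tangent vectors and the normal form a complete system in codimension one. -/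
theorem inverse_metric_decomposition {n : ℕ} {D T : Set (Coord (n + 1))} {O : Set (Coord n)}
    {G : TwoTensor (n + 1)} {f : Coord n → Coord (n + 1)} {ν : Coord n → Fin (n + 1) → ℝ}
    {x : Coord n} (hf : IsHypersurface D T O G f ν) (hx : x ∈ O) (a b : Fin (n + 1)) :
    invMetric G (f x) a b = (∑ k, ∑ l, invMetric (inducedMetric G f) x k l
      * tangent f x a k * tangent f x b l) + ν x a * ν x b := by
  let A : Matrix (Fin (n + 1)) (Fin (n + 1)) ℝ := Matrix.of (G (f x))
  let h : Matrix (Fin n) (Fin n) ℝ := Matrix.of (inducedMetric G f x)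
  let F : Matrix (Fin (n + 1)) (Fin n ⊕ Fin 1) ℝ :=
    Matrix.of fun a s => Sum.elim (fun i => tangent f x a i) (fun _ => ν x a) s
  let B : Matrix (Fin n ⊕ Fin 1) (Fin n ⊕ Fin 1) ℝ := Matrix.fromBlocks h⁻¹ 0 0 1
  have hAdet : IsUnit A.det :=
    isUnit_iff_ne_zero.2 (hf.metric.det_ne_zero _ (hf.mapsTo x hx))
  have hhdet : IsUnit h.det := isUnit_iff_ne_zero.2 (hf.isMetricOn_induced.det_ne_zero _ hx)
  have hpair : ∀ V W : Fin (n + 1) → ℝ, ∑ b, (∑ a, V a * G (f x) a b) * W b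
      = pairAlong G f x V W := by
    intro V W
    unfold pairAlong
    rw [Finset.sum_comm]
    simp only [Finset.sum_mul]
    exact Finset.sum_congr rfl fun _ _ => Finset.sum_congr rfl fun _ _ => by ring
  -- `F` has the tangent vectors and the normal as columns, so this is their Gram matrix.
  have hFAF : F.transpose * A * F = Matrix.fromBlocks h 0 0 1 := by
    ext s t
    rw [Matrix.mul_apply]
    simp only [Matrix.mul_apply, Matrix.transpose_apply]
    rw [show (∑ j, (∑ i, F i s * A i j) * F j t)
      = pairAlong G f x (fun a => F a s) (fun a => F a t) from hpair _ _]
    rcases s with i | i <;> rcases t with j | j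
    · rfl
    · exact hf.normal x hx i
    · rw [hf.pair_symm hx]
      exact hf.normal x hx j
    · rw [Subsingleton.elim i j, Matrix.fromBlocks_apply₂₂, Matrix.one_apply_eq]
      exact hf.unit x hx
  have h1 : (B * F.transpose * A) * F = 1 := by
    rw [Matrix.mul_assoc, Matrix.mul_assoc, ← Matrix.mul_assoc F.transpose, hFAF,
      Matrix.fromBlocks_multiply]
    simp [Matrix.nonsing_inv_mul _ hhdet]
  -- Codimension one enters here: `F` has as many columns as rows, so a left inverse is also a right
  -- inverse.
  have h2 : F * (B * F.transpose * A) = 1 :=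
    (Matrix.mul_eq_one_comm_of_card_eq _ _ _ (by simp)).1 h1
  have h3 : A⁻¹ = F * B * F.transpose := by
    rw [← Matrix.mul_assoc, ← Matrix.mul_assoc] at h2
    exact Matrix.inv_eq_left_inv h2
  have h4 : invMetric G (f x) a b = (F * B * F.transpose) a b := by
    rw [← h3]
    rfl
  rw [h4]
  simp only [Matrix.mul_apply, Matrix.transpose_apply, Fintype.sum_sum_type, F, B, Matrix.of_apply,
    Matrix.fromBlocks_apply₁₁, Matrix.fromBlocks_apply₁₂, Matrix.fromBlocks_apply₂₁,
    Matrix.fromBlocks_apply₂₂, Sum.elim_inl, Sum.elim_inr, Matrix.zero_apply, mul_zero,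
    Finset.sum_const_zero, add_zero, zero_add, Finset.univ_unique, Finset.sum_singleton,
    Matrix.one_apply_eq, mul_one, Finset.sum_mul]
  rw [Finset.sum_comm]
  congr 1
  refine Finset.sum_congr rfl fun k _ => Finset.sum_congr rfl fun l _ => ?_
  simp only [invMetric, h]
  ring

/-- Parseval's identity for the system of tangent vectors and unit normal, obtained by writing the
pairing as the inverse metric applied to the lowered vectors. -/
theorem pair_decomposition {n : ℕ} {D T : Set (Coord (n + 1))} {O : Set (Coord n)}
    {G : TwoTensor (n + 1)} {f : Coord n → Coord (n + 1)} {ν : Coord n → Fin (n + 1) → ℝ}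
    {x : Coord n} (hf : IsHypersurface D T O G f ν) (hx : x ∈ O) (U V : Fin (n + 1) → ℝ) :
    pairAlong G f x U V = (∑ k, ∑ l, invMetric (inducedMetric G f) x k l
        * pairAlong G f x U (fun a => tangent f x a k)
        * pairAlong G f x (fun a => tangent f x a l) V)
      + pairAlong G f x U (ν x) * pairAlong G f x (ν x) V := by
  have hfx := hf.mapsTo x hx
  -- `P` and `Q` are `U` and `V` with their indices lowered by the ambient metric.
  obtain ⟨P, hP⟩ : ∃ P : Fin (n + 1) → ℝ, ∀ b, P b = ∑ a, G (f x) a b * U a :=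
    ⟨_, fun _ => rfl⟩
  obtain ⟨Q, hQ⟩ : ∃ Q : Fin (n + 1) → ℝ, ∀ c, Q c = ∑ d, G (f x) c d * V d :=
    ⟨_, fun _ => rfl⟩
  have hl : ∀ W, pairAlong G f x U W = ∑ b, P b * W b := by
    intro W
    unfold pairAlong
    rw [Finset.sum_comm]
    simp only [hP, Finset.sum_mul]
  have hr : ∀ W, pairAlong G f x W V = ∑ c, W c * Q c := by
    intro W
    unfold pairAlong
    simp only [hQ, Finset.mul_sum]
    exact Finset.sum_congr rfl fun _ _ => Finset.sum_congr rfl fun _ _ => by ring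
  have h0 : pairAlong G f x U V = ∑ b, ∑ c, invMetric G (f x) b c * (P b * Q c) := by
    have hV : ∀ b, V b = ∑ c, invMetric G (f x) b c * Q c := by
      intro b
      simp only [hQ, Finset.mul_sum]
      rw [Finset.sum_comm]
      have : ∀ d, ∑ c, invMetric G (f x) b c * (G (f x) c d * V d)
          = (if b = d then 1 else 0) * V d := by
        intro d
        rw [← hf.metric.inv_mul hfx b d, Finset.sum_mul]
        exact Finset.sum_congr rfl fun _ _ => by ring
      simp [this]
    rw [hl]
    refine Finset.sum_congr rfl fun b _ => ?_
    rw [hV b, Finset.mul_sum]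
    exact Finset.sum_congr rfl fun _ _ => by ring
  rw [h0, hl (ν x), hr (ν x)]
  simp only [hl (fun a => tangent f x a _), hr (fun a => tangent f x a _),
    hf.inverse_metric_decomposition hx, add_mul, Finset.sum_add_distrib]
  congr 1
  · simp only [Finset.mul_sum, Finset.sum_mul]
    calc _ = ∑ b, ∑ k, ∑ c, ∑ l, invMetric (inducedMetric G f) x k l * tangent f x b k
            * tangent f x c l * (P b * Q c) := Finset.sum_congr rfl fun _ _ => Finset.sum_comm
      _ = ∑ k, ∑ b, ∑ c, ∑ l, invMetric (inducedMetric G f) x k l * tangent f x b k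
            * tangent f x c l * (P b * Q c) := Finset.sum_comm
      _ = ∑ k, ∑ b, ∑ l, ∑ c, invMetric (inducedMetric G f) x k l * tangent f x b k
            * tangent f x c l * (P b * Q c) := Finset.sum_congr rfl fun _ _ =>
              Finset.sum_congr rfl fun _ _ => Finset.sum_comm
      _ = ∑ k, ∑ l, ∑ b, ∑ c, invMetric (inducedMetric G f) x k l * tangent f x b k
            * tangent f x c l * (P b * Q c) := Finset.sum_congr rfl fun _ _ => Finset.sum_comm
      _ = _ := Finset.sum_congr rfl fun _ _ => Finset.sum_congr rfl fun _ _ => by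
            rw [Finset.sum_comm]
            exact Finset.sum_congr rfl fun _ _ => Finset.sum_congr rfl fun _ _ => by ring
  · simp only [Finset.mul_sum, Finset.sum_mul]
    rw [Finset.sum_comm]
    exact Finset.sum_congr rfl fun _ _ => Finset.sum_congr rfl fun _ _ => by ring

/-- The derivative of the normal is tangential, so pairing it with an ambient derivative of a
tangent field only sees the tangential part of the latter. -/
theorem pair_cov_tangent_cov_normal {n : ℕ} {D T : Set (Coord (n + 1))} {O : Set (Coord n)}
    {G : TwoTensor (n + 1)} {f : Coord n → Coord (n + 1)} {ν : Coord n → Fin (n + 1) → ℝ}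
    {x : Coord n} (hf : IsHypersurface D T O G f ν) (hx : x ∈ O) (i j k : Fin n) :
    pairAlong G f x (covAlong D G f (fun y b => tangent f y b k) x j) (covAlong D G f ν x i)
      = ∑ l, christoffel Set.univ (inducedMetric G f) x l j k
          * secondFundamentalForm D G f ν x i l := by
  rw [hf.pair_decomposition hx, hf.pair_symm hx (ν x) (covAlong D G f ν x i),
    hf.pair_cov_normal hx i, mul_zero, add_zero]
  simp only [hf.pair_tangent_cov_normal hx, hf.pair_cov_tangent hx]
  have hm := hf.isMetricOn_induced
  rw [Finset.sum_comm]
  refine Finset.sum_congr rfl fun l _ => ?_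
  rw [← Finset.sum_mul]
  congr 1
  simp only [Finset.mul_sum]
  rw [Finset.sum_comm]
  have : ∀ c, ∑ k', invMetric (inducedMetric G f) x k' l * (inducedMetric G f x k' c
      * christoffel Set.univ (inducedMetric G f) x c j k)
      = (if l = c then 1 else 0) * christoffel Set.univ (inducedMetric G f) x c j k := by
    intro c
    rw [← hm.inv_mul hx l c, Finset.sum_mul]
    exact Finset.sum_congr rfl fun b _ => by rw [hm.inv_symm hx b l]; ring
  simp [this]

end Induced

end IsHypersurface

/-! ### Reordering of iterated finite sums. -/

section Sums

variable {ι κ : Type*} [Fintype ι] [Fintype κ]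

theorem sum_sum_sum_sum_comm (F : ι → ι → κ → κ → ℝ) :
    ∑ j, ∑ k, ∑ b, ∑ c, F j k b c = ∑ b, ∑ c, ∑ j, ∑ k, F j k b c :=
  calc _ = ∑ j, ∑ b, ∑ k, ∑ c, F j k b c := Finset.sum_congr rfl fun _ _ => Finset.sum_comm
    _ = ∑ b, ∑ j, ∑ k, ∑ c, F j k b c := Finset.sum_comm
    _ = ∑ b, ∑ j, ∑ c, ∑ k, F j k b c := Finset.sum_congr rfl fun _ _ =>
        Finset.sum_congr rfl fun _ _ => Finset.sum_comm
    _ = _ := Finset.sum_congr rfl fun _ _ => Finset.sum_comm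

theorem sum_mul_outer_inner (p q : ι → ι → ℝ) :
    ∑ a, ∑ b, ∑ c, ∑ d, p b c * q a d = (∑ b, ∑ c, p b c) * ∑ a, ∑ d, q a d := by
  simp only [← Finset.mul_sum, ← Finset.sum_mul]

theorem sum_mul_interlaced (p q : ι → ι → ℝ) :
    ∑ a, ∑ b, ∑ c, ∑ d, p a c * q b d = (∑ a, ∑ c, p a c) * ∑ b, ∑ d, q b d := by
  rw [Finset.sum_congr rfl fun a _ => Finset.sum_comm]
  simp only [← Finset.mul_sum, ← Finset.sum_mul]

end Sums

/-! ### The Weyl tensor in dimension four -/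

section Weyl

variable {D T : Set (Coord 4)} {g : TwoTensor 4} {z : Coord 4}

theorem IsMetricOn.weyl_antisymm_right {n : ℕ} {D T : Set (Coord n)} {g : TwoTensor n}
    {z : Coord n} (hT : IsChartDomain D T) (hg : IsMetricOn D T g) (hz : z ∈ T)
    (i j k l : Fin n) : weyl D g z i j k l = -weyl D g z i j l k := by
  unfold weyl
  rw [hg.riemann_antisymm_right hT hz i j k l]
  ring

theorem IsMetricOn.sum_inv_mul_metric {n : ℕ} {D T : Set (Coord n)} {g : TwoTensor n}
    {z : Coord n} (hg : IsMetricOn D T g) (hz : z ∈ T) (X : Fin n → ℝ) (d : Fin n) :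
    ∑ b, ∑ c, invMetric g z b c * (X b * g z c d) = X d := by
  have : ∀ b, ∑ c, invMetric g z b c * (X b * g z c d) = X b * if b = d then 1 else 0 := by
    intro b
    rw [← hg.inv_mul hz b d, Finset.mul_sum]
    exact Finset.sum_congr rfl fun _ _ => by ring
  simp [this]

theorem IsMetricOn.sum_inv_mul_metric' {n : ℕ} {D T : Set (Coord n)} {g : TwoTensor n}
    {z : Coord n} (hg : IsMetricOn D T g) (hz : z ∈ T) (X : Fin n → ℝ) (d : Fin n) :
    ∑ b, ∑ c, invMetric g z b c * (X c * g z b d) = X d := by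
  rw [← hg.sum_inv_mul_metric hz X d, Finset.sum_comm]
  refine Finset.sum_congr rfl fun b _ => Finset.sum_congr rfl fun c _ => ?_
  rw [hg.inv_symm hz c b]

theorem IsMetricOn.trace_metric {n : ℕ} {D T : Set (Coord n)} {g : TwoTensor n}
    {z : Coord n} (hg : IsMetricOn D T g) (hz : z ∈ T) : trace g g z = n := by
  unfold trace
  have : ∀ i, ∑ j, invMetric g z i j * g z i j = 1 := by
    intro i
    rw [Finset.sum_congr rfl fun j _ => by rw [hg.symm z hz i j], hg.inv_mul hz i i, if_pos rfl]
  simp [this]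

/-- In dimension four the contraction of the Schouten part of the curvature is 2P + Jg, and this
equals Ric by the definition of P. -/
theorem IsMetricOn.weyl_trace (hT : IsChartDomain D T) (hg : IsMetricOn D T g) (hz : z ∈ T)
    (a d : Fin 4) : ∑ b, ∑ c, invMetric g z b c * weyl D g z a b c d = 0 := by
  have hR : ∑ b, ∑ c, invMetric g z b c * riemann D g z a b c d = ricci D g z a d := by
    rw [hg.ricci_eq hz]
    refine Finset.sum_congr rfl fun b _ => Finset.sum_congr rfl fun c _ => ?_
    rw [riemann_antisymm D g z a b, hg.riemann_antisymm_right hT hz, neg_neg]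
  have h1 : ∑ b, ∑ c, invMetric g z b c * (schouten D g z a c * g z b d) = schouten D g z a d :=
    hg.sum_inv_mul_metric' hz _ _
  have h3 : ∑ b, ∑ c, invMetric g z b c * (schouten D g z b d * g z a c) = schouten D g z a d := by
    simp only [hg.symm z hz a]
    rw [hg.sum_inv_mul_metric hz (fun b => schouten D g z b d) a]
  have h4 : ∑ b, ∑ c, invMetric g z b c * (schouten D g z a d * g z b c)
      = 4 * schouten D g z a d := by
    have h := hg.trace_metric hz
    unfold trace at h
    rw [show (4 : ℝ) = ((4 : ℕ) : ℝ) by norm_num, ← h]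
    simp only [Finset.sum_mul]
    exact Finset.sum_congr rfl fun _ _ => Finset.sum_congr rfl fun _ _ => by ring
  have hP : schouten D g z a d = (ricci D g z a d - schoutenJ D g z * g z a d) / 2 := by
    unfold schouten
    norm_num
  -- The factor is 2(n - 1) for n = 4.
  have hJ : trace g (ricci D g) z = 6 * schoutenJ D g z := by
    unfold schoutenJ
    push_cast
    ring
  have hPtr : ∑ b, ∑ c, invMetric g z b c * schouten D g z b c = schoutenJ D g z := by
    have h := hg.trace_metric hz
    unfold trace at h hJ
    have e : ∀ b c, invMetric g z b c * schouten D g z b c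
        = (1 / 2) * (invMetric g z b c * ricci D g z b c)
          - (schoutenJ D g z / 2) * (invMetric g z b c * g z b c) := by
      intro b c
      unfold schouten
      push_cast
      ring
    simp only [e, Finset.sum_sub_distrib, ← Finset.mul_sum]
    rw [h, hJ]
    push_cast
    ring
  have h2 : ∑ b, ∑ c, invMetric g z b c * (schouten D g z b c * g z a d)
      = schoutenJ D g z * g z a d := by
    rw [← hPtr]
    simp only [Finset.sum_mul, mul_assoc]
  have e : ∀ b c, invMetric g z b c * weyl D g z a b c d
      = invMetric g z b c * riemann D g z a b c d
        + invMetric g z b c * (schouten D g z a c * g z b d)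
        - invMetric g z b c * (schouten D g z b c * g z a d)
        + invMetric g z b c * (schouten D g z b d * g z a c)
        - invMetric g z b c * (schouten D g z a d * g z b c) := by
    intro b c
    unfold weyl
    ring
  simp only [e, Finset.sum_sub_distrib, Finset.sum_add_distrib]
  rw [hR, h1, h2, h3, h4, hP]
  ring

end Weyl

/-! ### The Codazzi equation, its Weyl form, and the identity in coordinates. -/

namespace IsHypersurface

section Codazzi

variable {n : ℕ} {D T : Set (Coord 4)} {O : Set (Coord n)} {G : TwoTensor 4}
  {f : Coord n → Coord 4} {ν : Coord n → Fin 4 → ℝ} {x : Coord n}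

/-- The commutator of covariant derivatives along `f` is the ambient curvature. -/
theorem cov_cov_sub (hf : IsHypersurface D T O G f ν) (hx : x ∈ O) {V : Coord n → Fin 4 → ℝ}
    (hV : ∀ a, SmoothIn Set.univ O (fun y => V y a)) (i j : Fin n) (a : Fin 4) :
    covAlong D G f (fun y => covAlong D G f V y j) x i a
        - covAlong D G f (fun y => covAlong D G f V y i) x j a
      = ∑ c, ∑ e, ∑ d, riemannUp D G (f x) c e d a
          * (tangent f x c i * tangent f x e j * V x d) := by
  have hcc : ∀ i j, covAlong D G f (fun y => covAlong D G f V y j) x i a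
      = pd Set.univ i (pd Set.univ j (fun y => V y a)) x
        + ∑ d, (pd Set.univ i (fun y => connAlong D G f y j a d) x * V x d
          + connAlong D G f x j a d * pd Set.univ i (fun y => V y d) x)
        + ∑ b, connAlong D G f x i a b * covAlong D G f V x j b := by
    intro i j
    conv_lhs => unfold covAlong
    rw [pd_add hf.dom ((hV a).pd hf.dom j)
      (SmoothIn.sum fun d => (hf.smooth_conn j a d).mul (hV d)) hx,
      pd_sum_mul hf.dom (fun d => hf.smooth_conn j a d) hV hx]
    rfl
  rw [hcc, hcc, pd_pd_comm hf.dom (hV a) hx i j]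
  -- This symmetry removes the terms with second derivatives of f; what remains are derivatives and
  -- products of Christoffel symbols, that is, the curvature.
  have hdt : ∀ c, pd Set.univ i (fun y => tangent f y c j) x
      = pd Set.univ j (fun y => tangent f y c i) x :=
    fun c => pd_pd_comm hf.dom (hf.smooth_map c) hx i j
  simp only [hf.pd_conn hx, hdt]
  unfold covAlong connAlong riemannUp
  simp only [Fin.sum_univ_four]
  ring

/-- The Codazzi equation. -/
theorem codazzi {O : Set (Coord 3)} {f : Coord 3 → Coord 4} {ν : Coord 3 → Fin 4 → ℝ}
    {x : Coord 3} (hf : IsHypersurface D T O G f ν) (hx : x ∈ O) (i j k : Fin 3) :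
    nabla2 Set.univ (inducedMetric G f) (secondFundamentalForm D G f ν) x i j k
        - nabla2 Set.univ (inducedMetric G f) (secondFundamentalForm D G f ν) x j i k
      = -∑ a, ∑ b, ∑ c, ∑ d, riemann D G (f x) a b c d
          * tangent f x a i * tangent f x b j * tangent f x c k * ν x d := by
  have hE := fun a => hf.smooth_tangent a k
  -- The derivative of L_{jk} = -⟨∇_j E_k, N⟩ falls on either factor. On N it gives a Christoffel
  -- term, which cancels a term of the covariant derivative after antisymmetrization.
  have hpd : ∀ i j, pd Set.univ i (fun y => secondFundamentalForm D G f ν y j k) x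
      = -pairAlong G f x
          (covAlong D G f (fun y => covAlong D G f (fun y b => tangent f y b k) y j) x i) (ν x)
        - ∑ l, christoffel Set.univ (inducedMetric G f) x l j k
          * secondFundamentalForm D G f ν x i l := by
    intro i j
    simp only [fun y => secondFundamentalForm_eq D G f ν y j k]
    rw [pd_neg hf.dom hx, hf.pd_pair (hf.smooth_cov hE j) hf.smooth_normal hx i,
      hf.pair_cov_tangent_cov_normal hx]
    ring
  have hm := hf.isMetricOn_induced
  unfold nabla2
  rw [hpd i j, hpd j i]
  have hΓ : ∑ a, christoffel Set.univ (inducedMetric G f) x a i j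
        * secondFundamentalForm D G f ν x a k
      = ∑ a, christoffel Set.univ (inducedMetric G f) x a j i
        * secondFundamentalForm D G f ν x a k :=
    Finset.sum_congr rfl fun a _ => by rw [hm.christoffel_symm hf.dom hx a i j]
  have hR : pairAlong G f x
        (covAlong D G f (fun y => covAlong D G f (fun y b => tangent f y b k) y j) x i) (ν x)
      - pairAlong G f x
        (covAlong D G f (fun y => covAlong D G f (fun y b => tangent f y b k) y i) x j) (ν x)
      = ∑ a, ∑ b, ∑ c, ∑ d, riemann D G (f x) a b c d
          * tangent f x a i * tangent f x b j * tangent f x c k * ν x d := by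
    rw [← pairAlong_sub_left]
    simp only [hf.cov_cov_sub hx hE]
    calc _ = ∑ p, ∑ a, ∑ b, ∑ c, ∑ d, riemannUp D G (f x) a b c p * G (f x) p d
            * tangent f x a i * tangent f x b j * tangent f x c k * ν x d := by
          unfold pairAlong
          refine Finset.sum_congr rfl fun p _ => ?_
          simp only [Finset.mul_sum, Finset.sum_mul]
          rw [Finset.sum_comm]
          refine Finset.sum_congr rfl fun a _ => ?_
          rw [Finset.sum_comm]
          refine Finset.sum_congr rfl fun b _ => ?_
          rw [Finset.sum_comm]
          exact Finset.sum_congr rfl fun c _ => Finset.sum_congr rfl fun d _ => by ring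
      _ = _ := by
          rw [Finset.sum_comm]
          refine Finset.sum_congr rfl fun a _ => ?_
          rw [Finset.sum_comm]
          refine Finset.sum_congr rfl fun b _ => ?_
          rw [Finset.sum_comm]
          refine Finset.sum_congr rfl fun c _ => ?_
          rw [Finset.sum_comm]
          refine Finset.sum_congr rfl fun d _ => ?_
          unfold riemann
          simp only [Finset.sum_mul]
  rw [← hR, hΓ]
  ring

/-- The trace of `W(E_i, ·, ·, N)` over the hypersurface vanishes. -/
theorem weylNormal_trace {O : Set (Coord 3)} {f : Coord 3 → Coord 4} {ν : Coord 3 → Fin 4 → ℝ}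
    {x : Coord 3} (hf : IsHypersurface D T O G f ν) (hx : x ∈ O) (i : Fin 3) :
    ∑ j, ∑ k, invMetric (inducedMetric G f) x j k * weylNormal D G f ν x i j k = 0 := by
  have hfx := hf.mapsTo x hx
  obtain ⟨φ, hφ⟩ : ∃ φ : Fin 4 → Fin 4 → ℝ, ∀ b c, φ b c
      = ∑ a, ∑ d, weyl D G (f x) a b c d * (tangent f x a i * ν x d) := ⟨_, fun _ _ => rfl⟩
  have hW : ∀ j k, weylNormal D G f ν x i j k
      = ∑ b, ∑ c, φ b c * (tangent f x b j * tangent f x c k) := by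
    intro j k
    unfold weylNormal
    simp only [hφ, Finset.sum_mul]
    rw [Finset.sum_comm]
    refine Finset.sum_congr rfl fun b _ => ?_
    rw [Finset.sum_comm]
    exact Finset.sum_congr rfl fun c _ => Finset.sum_congr rfl fun a _ =>
      Finset.sum_congr rfl fun d _ => by ring
  -- The full ambient trace vanishes because the Weyl tensor is trace free.
  have h1 : ∑ b, ∑ c, invMetric G (f x) b c * φ b c = 0 := by
    simp only [hφ, Finset.mul_sum]
    rw [sum_sum_sum_sum_comm]
    refine Finset.sum_eq_zero fun a _ => Finset.sum_eq_zero fun d _ => ?_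
    rw [← zero_mul (tangent f x a i * ν x d), ← hf.metric.weyl_trace hf.chart hfx a d]
    simp only [Finset.sum_mul, mul_assoc]
  -- The normal part of that trace is W(E_i, N, N, N), which vanishes by antisymmetry in the last
  -- two slots. The tangential trace is the difference of the two.
  have h2 : ∑ b, ∑ c, ν x b * ν x c * φ b c = 0 := by
    have h3 : ∀ b, ∑ c, ν x b * ν x c * φ b c = ∑ a, ∑ c, ∑ d,
        weyl D G (f x) a b c d * (ν x b * ν x c * tangent f x a i * ν x d) := by
      intro b
      simp only [hφ, Finset.mul_sum]
      rw [Finset.sum_comm]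
      exact Finset.sum_congr rfl fun a _ => Finset.sum_congr rfl fun c _ =>
        Finset.sum_congr rfl fun d _ => by ring
    simp only [h3]
    refine Finset.sum_eq_zero fun b _ => Finset.sum_eq_zero fun a _ => ?_
    have h4 : ∀ S : ℝ, S = -S → S = 0 := fun S hS => by linarith
    apply h4
    conv_lhs => rw [Finset.sum_comm]
    simp only [← Finset.sum_neg_distrib]
    refine Finset.sum_congr rfl fun c _ => Finset.sum_congr rfl fun d _ => ?_
    rw [hf.metric.weyl_antisymm_right hf.chart hfx a b d c]
    ring
  calc _ = ∑ j, ∑ k, ∑ b, ∑ c, φ b c * (invMetric (inducedMetric G f) x j k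
          * tangent f x b j * tangent f x c k) := by
        simp only [hW, Finset.mul_sum]
        exact Finset.sum_congr rfl fun _ _ => Finset.sum_congr rfl fun _ _ =>
          Finset.sum_congr rfl fun _ _ => Finset.sum_congr rfl fun _ _ => by ring
    _ = ∑ b, ∑ c, (invMetric G (f x) b c * φ b c - ν x b * ν x c * φ b c) := by
        rw [sum_sum_sum_sum_comm]
        refine Finset.sum_congr rfl fun b _ => Finset.sum_congr rfl fun c _ => ?_
        rw [hf.inverse_metric_decomposition hx b c]
        simp only [← Finset.mul_sum]
        ring
    _ = 0 := by
        simp only [Finset.sum_sub_distrib]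
        rw [h1, h2, sub_zero]

/-- The Codazzi equation, with the ambient curvature split into its Weyl and Schouten parts. -/
theorem codazzi_weyl {O : Set (Coord 3)} {f : Coord 3 → Coord 4} {ν : Coord 3 → Fin 4 → ℝ}
    {x : Coord 3} (hf : IsHypersurface D T O G f ν) (hx : x ∈ O) :
    ∃ s : Fin 3 → ℝ, ∀ i j k,
    nabla2 Set.univ (inducedMetric G f) (secondFundamentalForm D G f ν) x i j k
        - nabla2 Set.univ (inducedMetric G f) (secondFundamentalForm D G f ν) x j i k
      = -weylNormal D G f ν x i j k + s j * inducedMetric G f x i k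
        - s i * inducedMetric G f x j k := by
  -- The one-form is s_j = P(E_j, N) with the ambient Schouten tensor. The other two Schouten terms
  -- contain ⟨E, N⟩ = 0.
  refine ⟨fun j => ∑ b, ∑ d, schouten D G (f x) b d * tangent f x b j * ν x d, fun i j k => ?_⟩
  rw [hf.codazzi hx]
  have e : ∀ a b c d, riemann D G (f x) a b c d
          * tangent f x a i * tangent f x b j * tangent f x c k * ν x d
      = weyl D G (f x) a b c d * tangent f x a i * tangent f x b j * tangent f x c k * ν x d
        - (schouten D G (f x) a c * tangent f x a i * tangent f x c k)
          * (G (f x) b d * tangent f x b j * ν x d)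
        + (schouten D G (f x) b c * tangent f x b j * tangent f x c k)
          * (G (f x) a d * tangent f x a i * ν x d)
        - (G (f x) a c * tangent f x a i * tangent f x c k)
          * (schouten D G (f x) b d * tangent f x b j * ν x d)
        + (G (f x) b c * tangent f x b j * tangent f x c k)
          * (schouten D G (f x) a d * tangent f x a i * ν x d) := by
    intro a b c d
    unfold weyl
    ring
  simp only [e, Finset.sum_sub_distrib, Finset.sum_add_distrib]
  rw [sum_mul_interlaced (fun a c => schouten D G (f x) a c * tangent f x a i * tangent f x c k)
      (fun b d => G (f x) b d * tangent f x b j * ν x d),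
    sum_mul_outer_inner (fun b c => schouten D G (f x) b c * tangent f x b j * tangent f x c k)
      (fun a d => G (f x) a d * tangent f x a i * ν x d),
    sum_mul_interlaced (fun a c => G (f x) a c * tangent f x a i * tangent f x c k)
      (fun b d => schouten D G (f x) b d * tangent f x b j * ν x d),
    sum_mul_outer_inner (fun b c => G (f x) b c * tangent f x b j * tangent f x c k)
      (fun a d => schouten D G (f x) a d * tangent f x a i * ν x d),
    hf.normal x hx i, hf.normal x hx j]
  unfold weylNormal inducedMetric
  ring

/-- The identity of the theorem in local coordinates. -/
theorem divergence_identity {O : Set (Coord 3)} {f : Coord 3 → Coord 4} {ν : Coord 3 → Fin 4 → ℝ}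
    {x : Coord 3} (hf : IsHypersurface D T O G f ν) (hx : x ∈ O)
    {h : TwoTensor 3} (hh : h = inducedMetric G f)
    {A : TwoTensor 3} (hA : A = traceFree h (secondFundamentalForm D G f ν))
    {W : ThreeTensor 3} (hW : W = weylNormal D G f ν) :
    div1 Set.univ h (div2 Set.univ h (traceFree h (square h A))) x
        + inner2 h (schouten Set.univ h) (traceFree h (square h A)) x
      = (2 / 3) * inner2 h A (laplacian2 Set.univ h A) x
        + (1 / 3) * inner3 h (nabla2 Set.univ h A) (nabla2 Set.univ h A) x
        + (1 / 2) * inner1 h (div2 Set.univ h A) (div2 Set.univ h A) x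
        - (2 / 3) * schoutenJ Set.univ h x * inner2 h A A x
        + (4 / 3) * inner2 h A (div3 Set.univ h W) x
        - (1 / 2) * inner3 h W W x := by
  have hm : IsMetricOn Set.univ O h := hh ▸ hf.isMetricOn_induced
  have hLs := hf.smooth_secondFundamentalForm
  have hAs : ∀ i j, SmoothIn Set.univ O (fun y => A y i j) := by
    rw [hA]
    exact hm.smooth_traceFree hLs
  have hA_symm : ∀ y ∈ O, ∀ i j, A y i j = A y j i := by
    intro y hy i j
    rw [hA]
    unfold traceFree
    rw [hf.secondFundamentalForm_symm hy i j, hm.symm y hy i j]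
  have hA0 : ∀ y ∈ O, trace h A y = 0 := by
    intro y hy
    have htr := hm.trace_metric hy
    rw [hA]
    unfold trace traceFree at *
    simp only [mul_sub, Finset.sum_sub_distrib, mul_left_comm (invMetric h y _ _),
      ← Finset.mul_sum]
    rw [htr]
    unfold trace
    push_cast
    ring
  refine hm.divergence_square_identity hf.dom hAs hA_symm hA0 ?_ hx (hh ▸ hf.posDef_induced hx)
  intro y hy
  obtain ⟨s, hs⟩ := hf.codazzi_weyl hy
  rw [← hh, ← hW] at hs
  have hu := hm.smooth_trace hLs
  have hAL : ∀ k i j, nabla2 Set.univ h A y k i j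
      = nabla2 Set.univ h (secondFundamentalForm D G f ν) y k i j
        - pd Set.univ k (trace h (secondFundamentalForm D G f ν)) y / 3 * h y i j := by
    intro k i j
    have := nabla2_sub (g := h) hf.dom hLs (fun i j => (hu.div_const 3).mul (hm.smooth i j))
      hy k i j
    rw [hm.nabla2_smul_metric hf.dom (hu.div_const 3) hy, pd_div_const hf.dom hu hy] at this
    rw [← this, hA]
    unfold traceFree
    norm_num
  -- Passing from L to its trace-free part only changes the one-form that multiplies the metric, so
  -- both unknown contributions are collected in `t`.
  set t : Fin 3 → ℝ := fun k =>
    s k + pd Set.univ k (trace h (secondFundamentalForm D G f ν)) y / 3 with ht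
  have hC : ∀ k i j, W y k i j
      = -(nabla2 Set.univ h A y k i j - nabla2 Set.univ h A y i k j)
        + t i * h y k j - t k * h y i j := by
    intro k i j
    rw [hAL, hAL]
    have := hs k i j
    simp only [ht]
    linear_combination this
  have hB0 : ∀ k, ∑ i, ∑ j, invMetric h y i j * nabla2 Set.univ h A y k i j = 0 := fun k => by
    rw [← hm.pd_trace hf.dom hAs hy, pd_congr hf.dom hA0 hy, pd_const]
  have hdiv : ∀ k, ∑ i, ∑ j, invMetric h y i j * nabla2 Set.univ h A y i k j
      = div2 Set.univ h A y k := by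
    intro k
    unfold div2
    rw [Finset.sum_comm]
    exact Finset.sum_congr rfl fun _ _ => Finset.sum_congr rfl fun _ _ => by
      rw [nabla2_symm hf.dom hA_symm hy]
  -- Tracing the Codazzi relation over its last two indices gives 0 = d_k + t_k - 3t_k, since W and
  -- A are trace free there.
  have htd : ∀ k, t k = div2 Set.univ h A y k / 2 := by
    intro k
    have h0 := hf.weylNormal_trace hy k
    rw [← hh, ← hW] at h0
    have htr := hm.trace_metric hy
    unfold trace at htr
    have e : ∀ i j, invMetric h y i j * W y k i j
        = -(invMetric h y i j * nabla2 Set.univ h A y k i j)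
          + invMetric h y i j * nabla2 Set.univ h A y i k j
          + invMetric h y i j * (t i * h y j k) - t k * (invMetric h y i j * h y i j) := by
      intro i j
      rw [hC, hm.symm y hy k j]
      ring
    simp only [e, Finset.sum_sub_distrib, Finset.sum_add_distrib, Finset.sum_neg_distrib,
      ← Finset.mul_sum] at h0
    rw [hB0, hdiv, htr, hm.sum_inv_mul_metric hy] at h0
    push_cast at h0
    linarith
  intro k i j
  rw [hC, htd, htd]
  ring

end Codazzi

end IsHypersurface

/-! ### From manifolds to coordinates -/

section Chart

variable {m : ℕ} {H : Type*} [TopologicalSpace H]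
  {I : ModelWithCorners ℝ (EuclideanSpace ℝ (Fin m)) H}
  {X : Type*} [TopologicalSpace X]
  {ψ : OpenPartialHomeomorph X H}

theorem extend_target_mem_nhdsWithin_range {y : EuclideanSpace ℝ (Fin m)}
    (hy : y ∈ (ψ.extend I).target) : (ψ.extend I).target ∈ 𝓝[Set.range I] y := by
  have h := ψ.extend_target_mem_nhdsWithin (I := I) (y := (ψ.extend I).symm y)
    (by rw [← ψ.extend_source (I := I)]; exact (ψ.extend I).map_target hy)
  rwa [(ψ.extend I).right_inv hy] at h

theorem isChartDomain_extend_target (I : ModelWithCorners ℝ (EuclideanSpace ℝ (Fin m)) H)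
    (ψ : OpenPartialHomeomorph X H) :
    IsChartDomain (Set.range I) (ψ.extend I).target where
  subset := ψ.extend_target_subset_range
  mem_nhdsWithin _ hy := extend_target_mem_nhdsWithin_range hy
  uniqueDiffOn := I.uniqueDiffOn
  subset_closure := ψ.extend_target_subset_range.trans I.range_subset_closure_interior

variable [ChartedSpace H X]

theorem contMDiffOn_extend_symm_target (hψ : ψ ∈ IsManifold.maximalAtlas I ∞ X) :
    ContMDiffOn 𝓘(ℝ, EuclideanSpace ℝ (Fin m)) I ∞ (ψ.extend I).symm (ψ.extend I).target := by
  rw [ψ.extend_target']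
  exact contMDiffOn_extend_symm hψ

theorem mdifferentiableAt_extend (hψ : ψ ∈ IsManifold.maximalAtlas I ∞ X) {q : X}
    (hq : q ∈ ψ.source) :
    MDifferentiableAt I 𝓘(ℝ, EuclideanSpace ℝ (Fin m)) (ψ.extend I) q :=
  (ψ.contMDiffAt_extend hψ hq).mdifferentiableAt (by simp)

theorem mdifferentiableWithinAt_extend_symm (hψ : ψ ∈ IsManifold.maximalAtlas I ∞ X)
    {y : EuclideanSpace ℝ (Fin m)} (hy : y ∈ (ψ.extend I).target) :
    MDifferentiableWithinAt 𝓘(ℝ, EuclideanSpace ℝ (Fin m)) I (ψ.extend I).symm (Set.range I) y :=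
  (((contMDiffOn_extend_symm_target hψ) y hy).mono_of_mem_nhdsWithin
    (extend_target_mem_nhdsWithin_range hy)).mdifferentiableWithinAt (by simp)

/-- The components of a tangent vector in the chart `ψ`. -/
noncomputable def chartComponents (I : ModelWithCorners ℝ (EuclideanSpace ℝ (Fin m)) H)
    (ψ : OpenPartialHomeomorph X H) (q : X) (v : TangentSpace I q) : EuclideanSpace ℝ (Fin m) :=
  mfderiv I 𝓘(ℝ, EuclideanSpace ℝ (Fin m)) (ψ.extend I) q v

/-- Differentiate ψ⁻¹ ∘ ψ = id on the open chart source. The inverse chart is differentiated within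
the range of the model, since its domain need not be open when X has boundary. -/
theorem mfderivWithin_extend_symm_mfderiv_extend (hψ : ψ ∈ IsManifold.maximalAtlas I ∞ X)
    {y : EuclideanSpace ℝ (Fin m)} (hy : y ∈ (ψ.extend I).target)
    (v : TangentSpace I ((ψ.extend I).symm y)) :
    mfderivWithin 𝓘(ℝ, EuclideanSpace ℝ (Fin m)) I (ψ.extend I).symm (Set.range I) y
      (mfderiv I 𝓘(ℝ, EuclideanSpace ℝ (Fin m)) (ψ.extend I) ((ψ.extend I).symm y) v) = v := by
  have h'y : (ψ.extend I).symm y ∈ (ψ.extend I).source := (ψ.extend I).map_target hy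
  have h''y : (ψ.extend I).symm y ∈ ψ.source := by rwa [← ψ.extend_source (I := I)]
  have U' : UniqueMDiffWithinAt I (ψ.extend I).source ((ψ.extend I).symm y) :=
    (ψ.isOpen_extend_source (I := I)).uniqueMDiffWithinAt h'y
  have hd := mdifferentiableAt_extend hψ h''y
  suffices h : (mfderivWithin 𝓘(ℝ, EuclideanSpace ℝ (Fin m)) I (ψ.extend I).symm (Set.range I) y) ∘L
      (mfderiv I 𝓘(ℝ, EuclideanSpace ℝ (Fin m)) (ψ.extend I) ((ψ.extend I).symm y))
      = ContinuousLinearMap.id _ _ from congrArg (fun L => L v) h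
  rw [← mfderivWithin_eq_mfderiv U' hd, ← mfderivWithin_comp_of_eq]; rotate_left
  · exact mdifferentiableWithinAt_extend_symm hψ hy
  · exact hd.mdifferentiableWithinAt
  · exact fun z hz => ψ.extend_target_subset_range ((ψ.extend I).map_source hz)
  · exact U'
  · exact (ψ.extend I).right_inv hy
  rw [← mfderivWithin_id U']
  apply Filter.EventuallyEq.mfderivWithin_eq
  · filter_upwards [self_mem_nhdsWithin] with z hz
    simp only [Function.comp_def, (ψ.extend I).left_inv hz, id_eq]
  · simp only [Function.comp_def, (ψ.extend I).right_inv hy, id_eq]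

/-- Differentiate ψ ∘ ψ⁻¹ = id within the range of the model, where derivatives are unique. It makes
the differential of the inverse chart injective, which yields definiteness of the metric components.
-/
theorem mfderiv_extend_mfderivWithin_extend_symm (hψ : ψ ∈ IsManifold.maximalAtlas I ∞ X)
    {y : EuclideanSpace ℝ (Fin m)} (hy : y ∈ (ψ.extend I).target)
    (v : EuclideanSpace ℝ (Fin m)) :
    mfderiv I 𝓘(ℝ, EuclideanSpace ℝ (Fin m)) (ψ.extend I) ((ψ.extend I).symm y)
      (mfderivWithin 𝓘(ℝ, EuclideanSpace ℝ (Fin m)) I (ψ.extend I).symm (Set.range I) y v) = v := by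
  have h'y : (ψ.extend I).symm y ∈ (ψ.extend I).source := (ψ.extend I).map_target hy
  have h''y : (ψ.extend I).symm y ∈ ψ.source := by rwa [← ψ.extend_source (I := I)]
  have hyr := ψ.extend_target_subset_range hy
  have U' : UniqueMDiffWithinAt 𝓘(ℝ, EuclideanSpace ℝ (Fin m)) (Set.range I) y :=
    I.uniqueDiffOn.uniqueMDiffOn y hyr
  suffices h : (mfderiv I 𝓘(ℝ, EuclideanSpace ℝ (Fin m)) (ψ.extend I) ((ψ.extend I).symm y)) ∘L
      (mfderivWithin 𝓘(ℝ, EuclideanSpace ℝ (Fin m)) I (ψ.extend I).symm (Set.range I) y)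
      = ContinuousLinearMap.id _ _ from congrArg (fun L => L v) h
  rw [← mfderiv_comp_mfderivWithin y (mdifferentiableAt_extend hψ h''y)
    (mdifferentiableWithinAt_extend_symm hψ hy) U', ← mfderivWithin_id U']
  apply Filter.EventuallyEq.mfderivWithin_eq
  · filter_upwards [extend_target_mem_nhdsWithin_range hy] with z hz
    simp only [Function.comp_def, (ψ.extend I).right_inv hz, id_eq]
  · simp only [Function.comp_def, (ψ.extend I).right_inv hy, id_eq]

variable [IsManifold I ∞ X]
  (g : Bundle.ContMDiffRiemannianMetric I ∞ (EuclideanSpace ℝ (Fin m))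
      (fun q : X => TangentSpace I q))

theorem sum_metricInChart (ψ : OpenPartialHomeomorph X H) (y : EuclideanSpace ℝ (Fin m))
    (V W : EuclideanSpace ℝ (Fin m)) :
    ∑ a, ∑ b, metricInChart g ψ y a b * V a * W b
      = g.inner ((ψ.extend I).symm y)
        (mfderivWithin 𝓘(ℝ, EuclideanSpace ℝ (Fin m)) I (ψ.extend I).symm (Set.range I) y V)
        (mfderivWithin 𝓘(ℝ, EuclideanSpace ℝ (Fin m)) I (ψ.extend I).symm (Set.range I) y W) := by
  have hV : ∀ V : EuclideanSpace ℝ (Fin m),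
      mfderivWithin 𝓘(ℝ, EuclideanSpace ℝ (Fin m)) I (ψ.extend I).symm (Set.range I) y V
      = ∑ c, V c • coordVector I ψ y c := by
    intro V
    have : V = ∑ c, V c • EuclideanSpace.single c (1 : ℝ) := by
      ext a
      simp [Finset.sum_apply, Pi.single_apply]
    conv_lhs => rw [this]
    exact (map_sum _ _ _).trans (Finset.sum_congr rfl fun c _ => map_smul _ _ _)
  rw [hV V, hV W]
  simp only [map_sum, map_smul, sum_apply, smul_apply,
    smul_eq_mul, metricInChart, Finset.mul_sum]
  rw [Finset.sum_comm]
  refine Finset.sum_congr rfl fun a _ => Finset.sum_congr rfl fun b _ => ?_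
  ring

/-- Evaluating g on chart components recovers g on tangent vectors; the unit and normality
conditions are transferred to coordinates in this way. -/
theorem sum_metricInChart_mfderiv (hψ : ψ ∈ IsManifold.maximalAtlas I ∞ X) {q : X}
    (hq : q ∈ ψ.source) (v w : TangentSpace I q) :
    ∑ a, ∑ b, metricInChart g ψ (ψ.extend I q) a b
        * chartComponents I ψ q v a * chartComponents I ψ q w b
      = g.inner q v w := by
  rw [← ψ.extend_source (I := I)] at hq
  obtain ⟨y, hy, rfl⟩ : ∃ y ∈ (ψ.extend I).target, (ψ.extend I).symm y = q :=
    ⟨_, (ψ.extend I).map_source hq, (ψ.extend I).left_inv hq⟩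
  rw [(ψ.extend I).right_inv hy]
  exact (sum_metricInChart g ψ y _ _).trans
    (congrArg₂ (fun a b => g.inner ((ψ.extend I).symm y) a b)
      (mfderivWithin_extend_symm_mfderiv_extend hψ hy v)
      (mfderivWithin_extend_symm_mfderiv_extend hψ hy w))

theorem posDef_metricInChart (hψ : ψ ∈ IsManifold.maximalAtlas I ∞ X)
    {y : EuclideanSpace ℝ (Fin m)} (hy : y ∈ (ψ.extend I).target) :
    (Matrix.of (metricInChart g ψ y)).PosDef := by
  refine Matrix.PosDef.of_dotProduct_mulVec_pos ?_ fun v hv => ?_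
  · ext a b
    exact g.symm _ _ _
  · let V : EuclideanSpace ℝ (Fin m) := WithLp.toLp 2 v
    have h := sum_metricInChart g ψ y V V
    have hne : mfderivWithin 𝓘(ℝ, EuclideanSpace ℝ (Fin m)) I (ψ.extend I).symm (Set.range I) y V
        ≠ 0 := by
      intro h0
      have h1 := mfderiv_extend_mfderivWithin_extend_symm hψ hy V
      rw [h0, map_zero] at h1
      have h2 : V = 0 := h1.symm
      exact hv (funext fun a => congrArg (fun u : EuclideanSpace ℝ (Fin m) => u a) h2)
    have hpos := g.pos _ _ hne
    rw [← h] at hpos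
    refine hpos.trans_eq ?_
    simp only [dotProduct, Matrix.mulVec, Finset.mul_sum, star_trivial, Matrix.of_apply, V]
    exact Finset.sum_congr rfl fun _ _ => Finset.sum_congr rfl fun _ _ => by ring

/-- The coordinate field is the tangent map of the inverse chart applied to a constant section. -/
theorem contMDiffOn_coordVector (hψ : ψ ∈ IsManifold.maximalAtlas I ∞ X) (a : Fin m) :
    ContMDiffOn 𝓘(ℝ, EuclideanSpace ℝ (Fin m)) I.tangent ∞
      (fun y => (⟨(ψ.extend I).symm y, coordVector I ψ y a⟩ : TangentBundle I X))
      (ψ.extend I).target := by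
  have hU : UniqueMDiffOn 𝓘(ℝ, EuclideanSpace ℝ (Fin m)) (ψ.extend I).target := by
    rw [uniqueMDiffOn_iff_uniqueDiffOn, ψ.extend_target]
    exact I.uniqueDiffOn_preimage ψ.open_target
  have h1 := (contMDiffOn_extend_symm_target hψ).contMDiffOn_tangentMapWithin (m := ∞)
    (by simp) hU
  have h2 : ContMDiff 𝓘(ℝ, EuclideanSpace ℝ (Fin m)) 𝓘(ℝ, EuclideanSpace ℝ (Fin m)).tangent ∞
      (fun y : EuclideanSpace ℝ (Fin m) =>
        (⟨y, EuclideanSpace.single a (1 : ℝ)⟩ :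
          TangentBundle 𝓘(ℝ, EuclideanSpace ℝ (Fin m)) (EuclideanSpace ℝ (Fin m)))) :=
    contMDiff_vectorSpace_iff_contDiff.2 contDiff_const
  refine (h1.comp h2.contMDiffOn (fun y hy => hy)).congr fun y hy => ?_
  -- The range of the model and the chart target have the same germ at y, so derivatives within
  -- either agree.
  have h3 : mfderivWithin 𝓘(ℝ, EuclideanSpace ℝ (Fin m)) I (ψ.extend I).symm (Set.range I) y
      = mfderivWithin 𝓘(ℝ, EuclideanSpace ℝ (Fin m)) I (ψ.extend I).symm (ψ.extend I).target y := by
    refine mfderivWithin_congr_set ?_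
    rw [← nhdsWithin_eq_iff_eventuallyEq]
    exact (nhdsWithin_le_of_mem (extend_target_mem_nhdsWithin_range hy)).antisymm
      (nhdsWithin_mono _ ψ.extend_target_subset_range)
  simp only [Function.comp_apply, tangentMapWithin, coordVector, h3]

theorem smooth_metricInChart (hψ : ψ ∈ IsManifold.maximalAtlas I ∞ X) (a b : Fin m) :
    SmoothIn (Set.range I) (ψ.extend I).target (fun y => metricInChart g ψ y a b) := by
  intro y hy
  have hv := contMDiffOn_coordVector hψ a y hy
  have hw := contMDiffOn_coordVector hψ b y hy
  have hσ := contMDiffOn_extend_symm_target hψ y hy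
  have h : ContMDiffWithinAt 𝓘(ℝ, EuclideanSpace ℝ (Fin m)) (I.prod 𝓘(ℝ)) ∞
      (fun y => Bundle.TotalSpace.mk' ℝ (E := Bundle.Trivial X ℝ) ((ψ.extend I).symm y)
        (g.inner ((ψ.extend I).symm y) (coordVector I ψ y a) (coordVector I ψ y b)))
      (ψ.extend I).target y :=
    ContMDiffWithinAt.clm_bundle_apply₂ (F₁ := EuclideanSpace ℝ (Fin m))
      (F₂ := EuclideanSpace ℝ (Fin m))
      (ContMDiffAt.comp_contMDiffWithinAt y g.contMDiff.contMDiffAt hσ) hv hw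
  rw [Bundle.contMDiffWithinAt_totalSpace] at h
  exact (contMDiffWithinAt_iff_contDiffWithinAt.1 h.2).mono_of_mem_nhdsWithin
    (extend_target_mem_nhdsWithin_range hy)

theorem isMetricOn_metricInChart (hψ : ψ ∈ IsManifold.maximalAtlas I ∞ X) :
    IsMetricOn (Set.range I) (ψ.extend I).target (metricInChart g ψ) where
  smooth := smooth_metricInChart g hψ
  symm _ _ _ _ := g.symm _ _ _
  det_ne_zero _ hy := (posDef_metricInChart g hψ hy).det_pos.ne'

end Chart

/-! ### The hypersurface in a pair of charts. -/

section Charts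

variable {n m : ℕ} {H : Type*} [TopologicalSpace H]
  {I : ModelWithCorners ℝ (EuclideanSpace ℝ (Fin m)) H}
  {X : Type*} [TopologicalSpace X] {M : Type*} [TopologicalSpace M]
  {ψ : OpenPartialHomeomorph X H}
  {φ : OpenPartialHomeomorph M (EuclideanSpace ℝ (Fin n))}
  {ι : M → X} {U : Set M}

/-- The coordinates in the chart `φ` of the points of `U` that `ι` maps to the domain of `ψ`. -/
def coordDomain (ι : M → X) (φ : OpenPartialHomeomorph M (EuclideanSpace ℝ (Fin n)))
    (ψ : OpenPartialHomeomorph X H) (U : Set M) : Set (Coord n) :=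
  (φ.extend (𝓡 n)).target ∩ (φ.extend (𝓡 n)).symm ⁻¹' (U ∩ ι ⁻¹' ψ.source)

theorem isOpen_coordDomain (hι : Continuous ι) (hU : IsOpen U) :
    IsOpen (coordDomain ι φ ψ U) :=
  (φ.continuousOn_extend_symm (I := 𝓡 n)).isOpen_inter_preimage φ.isOpen_extend_target
    (hU.inter (ψ.open_source.preimage hι))

variable [ChartedSpace (EuclideanSpace ℝ (Fin n)) M]

theorem contMDiffAt_extend_symm (hφ : φ ∈ IsManifold.maximalAtlas (𝓡 n) ∞ M)
    {y : Coord n} (hy : y ∈ (φ.extend (𝓡 n)).target) :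
    ContMDiffAt (𝓡 n) (𝓡 n) ∞ (φ.extend (𝓡 n)).symm y :=
  (contMDiffOn_extend_symm_target hφ).contMDiffAt (φ.isOpen_extend_target.mem_nhds hy)

variable [ChartedSpace H X] {N : ∀ p : M, TangentSpace I (ι p)}

theorem contMDiffAt_mapInCharts (hφ : φ ∈ IsManifold.maximalAtlas (𝓡 n) ∞ M)
    (hψ : ψ ∈ IsManifold.maximalAtlas I ∞ X) (hι : ContMDiff (𝓡 n) I ∞ ι)
    {y : Coord n} (hy : y ∈ coordDomain ι φ ψ U) :
    ContMDiffAt (𝓡 n) (𝓡 m) ∞ (mapInCharts I ι φ ψ) y :=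
  (ψ.contMDiffAt_extend hψ hy.2.2).comp y
    ((hι.contMDiffAt (x := (φ.extend (𝓡 n)).symm y)).comp y (contMDiffAt_extend_symm hφ hy.1))

theorem smoothIn_mapInCharts (hφ : φ ∈ IsManifold.maximalAtlas (𝓡 n) ∞ M)
    (hψ : ψ ∈ IsManifold.maximalAtlas I ∞ X) (hι : ContMDiff (𝓡 n) I ∞ ι) (a : Fin m) :
    SmoothIn Set.univ (coordDomain ι φ ψ U) (fun y => mapInCharts I ι φ ψ y a) :=
  fun _ hy => contDiffWithinAt_euclidean.1
    (contMDiffAt_mapInCharts hφ hψ hι hy).contDiffAt.contDiffWithinAt a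

/-- The chain rule for ψ ∘ ι ∘ φ⁻¹. It identifies the coordinate tangent vectors as chart components
of vectors in the image of dι, to which injectivity and normality apply. -/
theorem fderiv_mapInCharts (hφ : φ ∈ IsManifold.maximalAtlas (𝓡 n) ∞ M)
    (hψ : ψ ∈ IsManifold.maximalAtlas I ∞ X) (hι : ContMDiff (𝓡 n) I ∞ ι)
    {y : Coord n} (hy : y ∈ coordDomain ι φ ψ U) (v : Coord n) :
    fderiv ℝ (mapInCharts I ι φ ψ) y v
      = chartComponents I ψ (ι ((φ.extend (𝓡 n)).symm y))
        (mfderiv (𝓡 n) I ι ((φ.extend (𝓡 n)).symm y)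
          (mfderiv (𝓡 n) (𝓡 n) (φ.extend (𝓡 n)).symm y v)) := by
  have h1 := (contMDiffAt_extend_symm hφ hy.1).mdifferentiableAt (by simp)
  have h2 := (hι.contMDiffAt (x := (φ.extend (𝓡 n)).symm y)).mdifferentiableAt (by simp)
  have h3 := mdifferentiableAt_extend hψ hy.2.2
  rw [← mfderiv_eq_fderiv]
  exact (mfderiv_comp_apply (g := ψ.extend I) (f := ι ∘ (φ.extend (𝓡 n)).symm) y h3
    (h2.comp y h1) v).trans
    (congrArg (mfderiv I (𝓡 m) (ψ.extend I) (ι ((φ.extend (𝓡 n)).symm y)))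
      (mfderiv_comp_apply (g := ι) (f := (φ.extend (𝓡 n)).symm) y h2 h1 v))

theorem sum_tangent_mapInCharts (hφ : φ ∈ IsManifold.maximalAtlas (𝓡 n) ∞ M)
    (hψ : ψ ∈ IsManifold.maximalAtlas I ∞ X) (hι : ContMDiff (𝓡 n) I ∞ ι)
    {y : Coord n} (hy : y ∈ coordDomain ι φ ψ U) (v : Fin n → ℝ) (a : Fin m) :
    ∑ i, tangent (mapInCharts I ι φ ψ) y a i * v i
      = fderiv ℝ (mapInCharts I ι φ ψ) y (WithLp.toLp 2 v) a := by
  have hd := (contMDiffAt_mapInCharts hφ hψ hι hy).contDiffAt.differentiableAt (by simp)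
  have h1 := hasFDerivWithinAt_euclidean.1 (hd.hasFDerivAt.hasFDerivWithinAt (s := Set.univ)) a
  have hv : (WithLp.toLp 2 v : Coord n) = ∑ c, v c • EuclideanSpace.single c (1 : ℝ) := by
    ext b
    simp [Finset.sum_apply, Pi.single_apply]
  rw [hv]
  simp only [map_sum, map_smul, tangent, pd, h1.fderivWithin uniqueDiffWithinAt_univ]
  simp [mul_comm]

theorem tangent_mapInCharts (hφ : φ ∈ IsManifold.maximalAtlas (𝓡 n) ∞ M)
    (hψ : ψ ∈ IsManifold.maximalAtlas I ∞ X) (hι : ContMDiff (𝓡 n) I ∞ ι)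
    {y : Coord n} (hy : y ∈ coordDomain ι φ ψ U) (a : Fin m) (i : Fin n) :
    tangent (mapInCharts I ι φ ψ) y a i
      = fderiv ℝ (mapInCharts I ι φ ψ) y (EuclideanSpace.single i 1) a := by
  simpa [Pi.single_apply] using sum_tangent_mapInCharts hφ hψ hι hy (Pi.single i 1) a

theorem eq_zero_of_chartComponents_eq_zero (hψ : ψ ∈ IsManifold.maximalAtlas I ∞ X) {q : X}
    (hq : q ∈ ψ.source) {v : TangentSpace I q} (hv : chartComponents I ψ q v = 0) : v = 0 := by
  rw [← ψ.extend_source (I := I)] at hq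
  obtain ⟨y, hy, rfl⟩ : ∃ y ∈ (ψ.extend I).target, (ψ.extend I).symm y = q :=
    ⟨_, (ψ.extend I).map_source hq, (ψ.extend I).left_inv hq⟩
  exact (mfderivWithin_extend_symm_mfderiv_extend hψ hy v).symm.trans
    ((congrArg _ hv).trans (map_zero _))

variable [IsManifold I ∞ X]

/-- The components are the fibre part of the tangent map of ψ applied to the smooth lift p ↦ (ι p, N
p). Since the chart source is open, the derivative within it is the full derivative. -/
theorem smoothIn_vectorInCharts (hφ : φ ∈ IsManifold.maximalAtlas (𝓡 n) ∞ M)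
    (hψ : ψ ∈ IsManifold.maximalAtlas I ∞ X) (hι : Continuous ι) (hU : IsOpen U)
    (hN : ContMDiffOn (𝓡 n) I.tangent ∞ (fun p => (⟨ι p, N p⟩ : TangentBundle I X)) U)
    (a : Fin m) :
    SmoothIn Set.univ (coordDomain ι φ ψ U) (fun y => vectorInCharts ι N φ ψ y a) := by
  intro y hy
  have h1 := (hN.contMDiffAt (hU.mem_nhds hy.2.1)).comp y (contMDiffAt_extend_symm hφ hy.1)
  have h2 := (OpenPartialHomeomorph.contMDiffOn_extend (I := I) hψ).contMDiffOn_tangentMapWithin (m := ∞) (by simp)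
    ψ.open_source.uniqueMDiffOn
  have hopen : IsOpen (Bundle.TotalSpace.proj ⁻¹' ψ.source : Set (TangentBundle I X)) :=
    ψ.open_source.preimage (FiberBundle.continuous_proj _ _)
  have h3 := (h2.contMDiffAt (hopen.mem_nhds (x := ⟨_, N ((φ.extend (𝓡 n)).symm y)⟩) hy.2.2)).comp
    y h1
  have h4 := (contMDiff_snd_tangentBundle_modelSpace (EuclideanSpace ℝ (Fin m)) (𝓡 m)
    (n := ∞)).contMDiffAt.comp y h3
  refine contDiffWithinAt_euclidean.1 (h4.contDiffAt.congr_of_eventuallyEq ?_).contDiffWithinAt a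
  filter_upwards [(isOpen_coordDomain hι hU).mem_nhds hy] with z hz
  ext b
  change vectorInCharts ι N φ ψ z b
    = (show EuclideanSpace ℝ (Fin m) from mfderivWithin I (𝓡 m) (ψ.extend I) ψ.source
        (ι ((φ.extend (𝓡 n)).symm z)) (N ((φ.extend (𝓡 n)).symm z))) b
  rw [mfderivWithin_of_isOpen ψ.open_source hz.2.2]
  rfl

theorem isHypersurface_inCharts (g : Bundle.ContMDiffRiemannianMetric I ∞ (EuclideanSpace ℝ (Fin m))
      (fun q : X => TangentSpace I q))
    (hφ : φ ∈ IsManifold.maximalAtlas (𝓡 n) ∞ M)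
    (hψ : ψ ∈ IsManifold.maximalAtlas I ∞ X) (hι : ContMDiff (𝓡 n) I ∞ ι)
    (hdι : ∀ p : M, Function.Injective (mfderiv (𝓡 n) I ι p))
    (hU : IsOpen U) (hN : IsUnitNormalOn (n := n) g ι N U) :
    IsHypersurface (Set.range I) (ψ.extend I).target (coordDomain ι φ ψ U) (metricInChart g ψ)
      (mapInCharts I ι φ ψ) (vectorInCharts ι N φ ψ) where
  isOpen := isOpen_coordDomain hι.continuous hU
  chart := isChartDomain_extend_target I ψ
  metric := isMetricOn_metricInChart g hψ
  posDef _ hz := posDef_metricInChart g hψ hz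
  smooth_map := smoothIn_mapInCharts hφ hψ hι
  mapsTo _ hy := (ψ.extend I).map_source (by rw [ψ.extend_source]; exact hy.2.2)
  injective y hy v hv := by
    have h0 : fderiv ℝ (mapInCharts I ι φ ψ) y (WithLp.toLp 2 v) = 0 := by
      ext a
      rw [← sum_tangent_mapInCharts hφ hψ hι hy]
      exact hv a
    rw [fderiv_mapInCharts hφ hψ hι hy] at h0
    have h1 := (eq_zero_of_chartComponents_eq_zero hψ hy.2.2 h0)
    have h2 := hdι _ (h1.trans (map_zero _).symm)
    have h3 := mfderiv_extend_mfderivWithin_extend_symm hφ hy.1 (WithLp.toLp 2 v)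
    rw [(𝓡 n).range_eq_univ, mfderivWithin_univ, h2, map_zero] at h3
    have h4 : (WithLp.toLp 2 v : Coord n) = 0 := h3.symm
    exact funext fun a => congrArg (fun u : Coord n => u a) h4
  smooth_normal := smoothIn_vectorInCharts hφ hψ hι.continuous hU hN.smooth
  unit y hy := (sum_metricInChart_mfderiv g hψ hy.2.2 _ _).trans (hN.unit _ hy.2.1)
  normal y hy i := by
    simp only [tangent_mapInCharts hφ hψ hι hy, fderiv_mapInCharts hφ hψ hι hy]
    exact (sum_metricInChart_mfderiv g hψ hy.2.2 _ _).trans (hN.normal _ hy.2.1 _)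

end Charts

end Hypersurface

/-- Both sides are scalars at a point, so the statement is made in arbitrary charts around p and ι
p. Derivatives on M are unrestricted because M has no boundary. -/
theorem lemma3p9
    {M : Type*} [TopologicalSpace M] [ChartedSpace (EuclideanSpace ℝ (Fin 3)) M]
    [IsManifold (𝓡 3) ∞ M]
    {H : Type*} [TopologicalSpace H] (I : ModelWithCorners ℝ (EuclideanSpace ℝ (Fin 4)) H)
    {X : Type*} [TopologicalSpace X] [ChartedSpace H X] [IsManifold I ∞ X]
    (g : Bundle.ContMDiffRiemannianMetric I ∞ (EuclideanSpace ℝ (Fin 4))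
      (fun q : X => TangentSpace I q))
    -- a smooth embedding of `M` as a hypersurface
    (ι : M → X) (hι : ContMDiff (𝓡 3) I ∞ ι)
    (hdι : ∀ p : M, Function.Injective (mfderiv (𝓡 3) I ι p))
    (hemb : Topology.IsEmbedding ι)
    -- a unit normal field, possibly only defined locally
    (U : Set M) (hU : IsOpen U) (N : ∀ p : M, TangentSpace I (ι p))
    (hN : IsUnitNormalOn (n := 3) g ι N U)
    -- arbitrary local coordinates on `M` and on `X` around a point and its image
    (φ : OpenPartialHomeomorph M (EuclideanSpace ℝ (Fin 3)))
    (hφ : φ ∈ IsManifold.maximalAtlas (𝓡 3) ∞ M)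
    (ψ : OpenPartialHomeomorph X H) (hψ : ψ ∈ IsManifold.maximalAtlas I ∞ X)
    (p : M) (hpU : p ∈ U) (hpφ : p ∈ φ.source) (hpψ : ι p ∈ ψ.source) :
    let x : Coord 3 := φ.extend (𝓡 3) p
    let E : Set (Coord 3) := Set.univ
    let D : Set (Coord 4) := Set.range I
    let G : TwoTensor 4 := metricInChart g ψ
    let f : Coord 3 → Coord 4 := mapInCharts I ι φ ψ
    let ν : Coord 3 → Fin 4 → ℝ := vectorInCharts ι N φ ψ
    let h : TwoTensor 3 := inducedMetric G f
    let L₀ : TwoTensor 3 := traceFree h (secondFundamentalForm D G f ν)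
    let W₀ : ThreeTensor 3 := weylNormal D G f ν
    div1 E h (div2 E h (traceFree h (square h L₀))) x
        + inner2 h (schouten E h) (traceFree h (square h L₀)) x
      = (2 / 3) * inner2 h L₀ (laplacian2 E h L₀) x
        + (1 / 3) * inner3 h (nabla2 E h L₀) (nabla2 E h L₀) x
        + (1 / 2) * inner1 h (div2 E h L₀) (div2 E h L₀) x
        - (2 / 3) * schoutenJ E h x * inner2 h L₀ L₀ x
        + (4 / 3) * inner2 h L₀ (div3 E h W₀) x
        - (1 / 2) * inner3 h W₀ W₀ x := by
  intro x E D G f ν h L₀ W₀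
  have hx : x ∈ coordDomain ι φ ψ U := by
    have hp : p ∈ (φ.extend (𝓡 3)).source := by rwa [φ.extend_source]
    refine ⟨(φ.extend (𝓡 3)).map_source hp, ?_⟩
    rw [Set.mem_preimage, (φ.extend (𝓡 3)).left_inv hp]
    exact ⟨hpU, hpψ⟩
  exact (isHypersurface_inCharts g hφ hψ hι hdι hU hN).divergence_identity hx rfl rfl rfl
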